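/- A $p$-cycle ($p\ge 3$) is a connected 2-regular graph with $p$ vertices. A (polyhedral) map $M$ is a finite collection of cycles, called faces, on a vertex set $V$ such that every vertex lies on a face; any two different faces meet in the empty set, a single vertex or a single edge; for each vertex $v$ the faces containing $v$ can be arranged in a cyclic sequence $C_1,\dots,C_m$ with $m\ge 3$ such that $C_1\cap C_2,\dots,C_{m-1}\cap C_m,C_m\cap C_1$ are $m$ different edges; and the geometric carrier $|M|$, obtained by filling each face with a polygonal disc, is connected. $M$ is semi-equivelar of type $(3^3,4^2)$ (resp. $(3^2,4,3,4)$) if at every vertex the sizes of the faces in cyclic order are, up to a cyclic permutation, $3,3,3,4,4$ (resp. $3,3,4,3,4$). An isomorphism of maps is a bijection of the vertex sets under which faces correspond to faces. $M$ is on the torus or the Klein bottle if $|M|$ is homeomorphic to that surface. **Lemma.** Let $M$ be a semi-equivelar map with at most $15$ vertices on the torus or the Klein bottle. (a) If $M$ has type $(3^3,4^2)$, then $M$ is isomorphic to one of $T_{1,10}$, $T_{1,12}$, $T_{2,12}$, $T_{3,12}$, $T_{1,14}$, $T_{2,14}$, $K_{1,10}$, $K_{1,12}$, $K_{2,12}$,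 $K_{1,14}$ listed below; in particular it does not have exactly $8$ vertices. (b) If $M$ has type $(3^2,4,3,4)$, then $M$ is isomorphic to $K_{1,12}(3^2,4,3,4)$ listed below; in particular it does not have exactly $8$, $10$ or $14$ vertices. Moreover the ten maps in (a) are semi-equivelar maps of type $(3^3,4^2)$, and $K_{1,12}(3^2,4,3,4)$ is a semi-equivelar map of type $(3^2,4,3,4)$. The eleven maps, where $[a,b,c]$ and $[a,b,c,d]$ denote the faces with these vertices in cyclic order, are: - $T_{1,10}(3^3,4^2)$, vertices $0,\dots,9$, faces: $[5,4,0]$, $[5,0,6]$, $[4,7,3]$, $[4,3,0]$, $[7,1,8]$, $[7,8,3]$, $[1,2,9]$, $[1,9,8]$, $[2,5,6]$, $[2,6,9]$, $[6,0,1,7]$, $[0,3,2,1]$, $[3,8,5,2]$, $[8,9,4,5]$, $[9,6,7,4]$. - $T_{1,12}(3^3,4^2)$, vertices $0,\dots,11$, faces: $[5,4,0]$, $[5,0,6]$, $[4,11,3]$, $[4,3,0]$, $[11,7,10]$, $[11,10,3]$, $[7,1,8]$, $[7,8,10]$, $[1,2,9]$, $[1,9,8]$, $[2,5,6]$, $[2,6,9]$,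 $[6,0,1,7]$, $[0,3,2,1]$, $[3,10,5,2]$, $[10,8,4,5]$, $[8,9,11,4]$, $[9,6,7,11]$. - $T_{2,12}(3^3,4^2)$, vertices $0,\dots,11$, faces: $[8,10,7]$, $[10,2,7]$, $[10,9,2]$, $[9,1,2]$, $[9,8,1]$, $[8,7,1]$, $[6,3,11]$, $[3,4,11]$, $[3,0,4]$, $[0,5,4]$, $[0,6,5]$, $[6,11,5]$, $[7,2,3,6]$, $[2,1,0,3]$, $[1,7,6,0]$, $[11,4,8,9]$, $[4,5,10,8]$, $[5,11,9,10]$. - $T_{3,12}(3^3,4^2)$, vertices $0,\dots,11$, faces: $[8,10,7]$, $[10,2,7]$, $[10,9,2]$, $[9,1,2]$, $[9,8,1]$, $[8,7,1]$, $[6,3,11]$, $[3,4,11]$, $[3,0,4]$, $[0,5,4]$, $[0,6,5]$, $[6,11,5]$, $[7,2,3,6]$, $[2,1,0,3]$, $[1,7,6,0]$, $[11,4,9,10]$, $[4,5,8,9]$, $[5,11,10,8]$. - $T_{1,14}(3^3,4^2)$, vertices $0,\dots,13$, faces: $[5,4,0]$, $[5,0,6]$, $[4,7,3]$, $[4,3,0]$,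 $[7,1,8]$, $[7,8,3]$, $[1,2,9]$, $[1,9,8]$, $[2,11,10]$, $[2,10,9]$, $[11,12,13]$, $[11,13,10]$, $[12,5,6]$, $[12,6,13]$, $[6,0,1,7]$, $[0,3,2,1]$, $[3,8,11,2]$, $[8,9,12,11]$, $[9,10,5,12]$, $[10,13,4,5]$, $[13,6,7,4]$. - $T_{2,14}(3^3,4^2)$, vertices $0,\dots,13$, faces: $[5,4,0]$, $[5,0,6]$, $[4,13,3]$, $[4,3,0]$, $[13,7,12]$, $[13,12,3]$, $[7,1,8]$, $[7,8,12]$, $[1,2,9]$, $[1,9,8]$, $[2,11,10]$, $[2,10,9]$, $[11,5,6]$, $[11,6,10]$, $[6,0,1,7]$, $[0,3,2,1]$, $[3,12,11,2]$, $[12,8,5,11]$, $[8,9,4,5]$, $[9,10,13,4]$, $[10,6,7,13]$. - $K_{1,10}(3^3,4^2)$, vertices $0,\dots,9$, faces: $[5,6,0]$, $[4,0,3]$, $[6,3,5]$, $[5,4,0]$, $[4,6,3]$, $[8,7,1]$, $[9,1,2]$, $[7,2,8]$, $[8,9,1]$, $[9,7,2]$, $[8,9,4,5]$, $[9,7,6,4]$,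 $[6,0,1,7]$, $[0,3,2,1]$, $[3,5,8,2]$. - $K_{1,12}(3^3,4^2)$, vertices $0,\dots,11$, faces: $[10,9,2]$, $[10,2,6]$, $[9,8,1]$, $[9,1,2]$, $[8,11,7]$, $[8,7,1]$, $[7,3,11]$, $[3,4,11]$, $[3,0,4]$, $[0,5,4]$, $[0,6,5]$, $[6,10,5]$, $[11,4,9,10]$, $[4,5,8,9]$, $[5,10,11,8]$, $[6,2,3,7]$, $[2,1,0,3]$, $[1,7,6,0]$. - $K_{2,12}(3^3,4^2)$, vertices $0,\dots,11$, faces: $[11,5,6]$, $[5,0,6]$, $[5,4,0]$, $[4,3,0]$, $[4,11,3]$, $[11,6,3]$, $[7,1,8]$, $[1,9,8]$, $[1,2,9]$, $[2,10,9]$, $[2,7,10]$, $[7,8,10]$, $[6,0,1,7]$, $[0,3,2,1]$, $[3,6,7,2]$, $[8,9,5,4]$, $[9,10,11,5]$, $[10,8,4,11]$. - $K_{1,14}(3^3,4^2)$, vertices $0,\dots,13$, faces: $[5,6,0]$, $[4,0,3]$, $[13,3,12]$, $[6,12,5]$, $[5,4,0]$, $[4,13,3]$, $[13,6,12]$, $[8,7,1]$,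 $[9,1,2]$, $[10,2,11]$, $[7,11,8]$, $[8,9,1]$, $[9,10,2]$, $[10,7,11]$, $[6,0,1,7]$, $[0,3,2,1]$, $[3,12,11,2]$, $[12,5,8,11]$, $[8,9,4,5]$, $[9,10,13,4]$, $[10,7,6,13]$. - $K_{1,12}(3^2,4,3,4)$, vertices $0,\dots,11$, faces: $[5,8,4]$, $[5,4,0]$, $[9,6,7]$, $[9,7,11]$, $[7,0,1]$, $[0,2,1]$, $[4,11,3]$, $[11,10,3]$, $[2,3,8]$, $[2,8,9]$, $[10,1,6]$, $[10,6,5]$, $[6,5,0,7]$, $[8,9,11,4]$, $[0,4,3,2]$, $[11,7,1,10]$, $[1,2,9,6]$, $[3,10,5,8]$. -/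

import Mathlib

namespace SemiEquivelar

/-! ### Cycles and polyhedral complexes

A cycle is represented by its (finite) set of edges, which determines it as a graph. -/

section Complex

variable {V : Type*} [DecidableEq V]

/-- The edges `l₀l₁, l₁l₂, …, lₖl₀` of the closed polygon through the vertices of the list `l`. -/
def cycleEdges (l : List V) : Finset (Sym2 V) :=
  (List.zipWith (fun a b => s(a, b)) l (l.rotate 1)).toFinset

/-- `C` is (the edge set of) a `p`-cycle for some `p ≥ 3`. The number `p` is `C.card`. -/
def IsCycle (C : Finset (Sym2 V)) : Prop :=
  ∃ l : List V, l.Nodup ∧ 3 ≤ l.length ∧ cycleEdges l = C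

/-- The vertices of a cycle. -/
def verts (C : Finset (Sym2 V)) : Finset V :=
  C.biUnion Sym2.toFinset

/-- The intersection of the cycles `C` and `D`, as graphs, is exactly the edge `e`
(with its two end points). -/
def MeetInEdge (C D : Finset (Sym2 V)) (e : Sym2 V) : Prop :=
  C ∩ D = {e} ∧ verts C ∩ verts D = e.toFinset

/-- A finite collection `K` of cycles is a polyhedral complex with vertex set `V`: its members,
the faces, are cycles, every point of `V` is a vertex of a face, and any two different faces meet
in the empty set, a vertex or an edge. -/
structure IsPolyhedralComplex (K : Finset (Finset (Sym2 V))) : Prop where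
  isCycle : ∀ C ∈ K, IsCycle C
  covers : ∀ v : V, ∃ C ∈ K, v ∈ verts C
  inter : ∀ C ∈ K, ∀ D ∈ K, C ≠ D →
    verts C ∩ verts D = ∅ ∨ (∃ v, verts C ∩ verts D = {v}) ∨ ∃ e, MeetInEdge C D e

/-- `L = [C₁, …, Cₘ]` lists the faces of `K` that contain `v`, each one once and in their cyclic
order around `v`: `m ≥ 3`, and `C₁ ∩ C₂, …, Cₘ₋₁ ∩ Cₘ, Cₘ ∩ C₁` are `m` different edges. -/
def IsFaceCycle (K : Finset (Finset (Sym2 V))) (v : V) (L : List (Finset (Sym2 V))) : Prop :=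
  3 ≤ L.length ∧ L.Nodup ∧ (∀ C, C ∈ L ↔ C ∈ K ∧ v ∈ verts C) ∧
    ∃ E : List (Sym2 V), E.Nodup ∧
      List.Forall₂ (fun p e => MeetInEdge p.1 p.2 e) (L.zip (L.rotate 1)) E

/-- Polyhedral 2-manifolds. -/
structure IsPolyhedralManifold (K : Finset (Finset (Sym2 V))) : Prop
    extends IsPolyhedralComplex K where
  exists_faceCycle : ∀ v : V, ∃ L, IsFaceCycle K v L

/-- The geometric carrier of `K`, in a real vector space with one coordinate for each vertex and
one for each possible face. The polygon with boundary cycle `C` is realised as the cone over that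
cycle, with an apex that belongs to `C` only: it is the union, over the edges `e` of `C`, of the
triangles spanned by the apex and the two ends of `e`. The carrier is the union of the polygons
of all faces. -/
def carrier (K : Finset (Finset (Sym2 V))) : Set (V ⊕ Finset (Sym2 V) → ℝ) :=
  ⋃ C ∈ K, ⋃ e ∈ C, convexHull ℝ
    (insert (Pi.single (Sum.inr C) 1) ((fun v : V => Pi.single (Sum.inl v) 1) '' {v | v ∈ e}))

/-- (Polyhedral) maps: connected finite polyhedral 2-manifolds. -/
structure IsMap (K : Finset (Finset (Sym2 V))) : Prop extends IsPolyhedralManifold K where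
  connected : IsConnected (carrier K)

/-- The sizes of the faces around `v`, in cyclic order, form the sequence `s`, up to a cyclic
permutation. (A list of faces around `v` may be read in either direction.) -/
def HasFaceSequence (K : Finset (Finset (Sym2 V))) (v : V) (s : List ℕ) : Prop :=
  ∃ L, IsFaceCycle K v L ∧ List.IsRotated (L.map Finset.card) s

/-- Semi-equivelar maps of type `s`. -/
structure IsSEM (K : Finset (Finset (Sym2 V))) (s : List ℕ) : Prop extends IsMap K where
  faceSequence : ∀ v : V, HasFaceSequence K v s

/-- Isomorphism: a bijection of the vertices under which faces correspond to faces. -/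
def Iso {W : Type*} [DecidableEq W] (K : Finset (Finset (Sym2 V)))
    (K' : Finset (Finset (Sym2 W))) : Prop :=
  ∃ f : V ≃ W, ∀ C : Finset (Sym2 V), C.image (Sym2.map f) ∈ K' ↔ C ∈ K

end Complex

/-! ### The two surfaces -/

/-- The torus. -/
abbrev Torus : Type := Circle × Circle

/-- The identifications of boundary points of the unit square that produce the Klein bottle. -/
inductive KleinRel : unitInterval × unitInterval → unitInterval × unitInterval → Prop
  | side (y : unitInterval) : KleinRel (0, y) (1, y)
  | flip (x : unitInterval) : KleinRel (x, 0) (unitInterval.symm x, 1)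

/-- The Klein bottle, with the quotient topology. -/
abbrev KleinBottle : Type := Quot KleinRel

/-- The carrier of `K` is a torus. -/
def OnTorus {V : Type*} [DecidableEq V] (K : Finset (Finset (Sym2 V))) : Prop :=
  Nonempty (carrier K ≃ₜ Torus)

/-- The carrier of `K` is a Klein bottle. -/
def OnKleinBottle {V : Type*} [DecidableEq V] (K : Finset (Finset (Sym2 V))) : Prop :=
  Nonempty (carrier K ≃ₜ KleinBottle)

/-! ### The eleven maps

The vertex `vᵢ` is `i`; each face is given by its vertices in cyclic order. -/

/-- The type `(3³, 4²)`. -/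
def type33344 : List ℕ := [3, 3, 3, 4, 4]

/-- The type `(3², 4, 3, 4)`. -/
def type33434 : List ℕ := [3, 3, 4, 3, 4]

/-- The collection of cycles with the given vertex lists. -/
def ofLists {n : ℕ} (F : List (List (Fin n))) : Finset (Finset (Sym2 (Fin n))) :=
  (F.map cycleEdges).toFinset

/-- The map `T_{1,10}(3³, 4²)`. -/
def T_1_10 : Finset (Finset (Sym2 (Fin 10))) :=
  ofLists
    [[5, 4, 0], [5, 0, 6], [4, 7, 3], [4, 3, 0], [7, 1, 8], [7, 8, 3], [1, 2, 9],
      [1, 9, 8], [2, 5, 6], [2, 6, 9], [6, 0, 1, 7], [0, 3, 2, 1], [3, 8, 5, 2],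
      [8, 9, 4, 5], [9, 6, 7, 4]]

/-- The map `T_{1,12}(3³, 4²)`. -/
def T_1_12 : Finset (Finset (Sym2 (Fin 12))) :=
  ofLists
    [[5, 4, 0], [5, 0, 6], [4, 11, 3], [4, 3, 0], [11, 7, 10], [11, 10, 3], [7, 1, 8],
      [7, 8, 10], [1, 2, 9], [1, 9, 8], [2, 5, 6], [2, 6, 9], [6, 0, 1, 7], [0, 3, 2, 1],
      [3, 10, 5, 2], [10, 8, 4, 5], [8, 9, 11, 4], [9, 6, 7, 11]]

/-- The map `T_{2,12}(3³, 4²)`. -/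
def T_2_12 : Finset (Finset (Sym2 (Fin 12))) :=
  ofLists
    [[8, 10, 7], [10, 2, 7], [10, 9, 2], [9, 1, 2], [9, 8, 1], [8, 7, 1], [6, 3, 11],
      [3, 4, 11], [3, 0, 4], [0, 5, 4], [0, 6, 5], [6, 11, 5], [7, 2, 3, 6], [2, 1, 0, 3],
      [1, 7, 6, 0], [11, 4, 8, 9], [4, 5, 10, 8], [5, 11, 9, 10]]

/-- The map `T_{3,12}(3³, 4²)`. -/
def T_3_12 : Finset (Finset (Sym2 (Fin 12))) :=
  ofLists
    [[8, 10, 7], [10, 2, 7], [10, 9, 2], [9, 1, 2], [9, 8, 1], [8, 7, 1], [6, 3, 11],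
      [3, 4, 11], [3, 0, 4], [0, 5, 4], [0, 6, 5], [6, 11, 5], [7, 2, 3, 6], [2, 1, 0, 3],
      [1, 7, 6, 0], [11, 4, 9, 10], [4, 5, 8, 9], [5, 11, 10, 8]]

/-- The map `T_{1,14}(3³, 4²)`. -/
def T_1_14 : Finset (Finset (Sym2 (Fin 14))) :=
  ofLists
    [[5, 4, 0], [5, 0, 6], [4, 7, 3], [4, 3, 0], [7, 1, 8], [7, 8, 3], [1, 2, 9],
      [1, 9, 8], [2, 11, 10], [2, 10, 9], [11, 12, 13], [11, 13, 10], [12, 5, 6],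
      [12, 6, 13], [6, 0, 1, 7], [0, 3, 2, 1], [3, 8, 11, 2], [8, 9, 12, 11],
      [9, 10, 5, 12], [10, 13, 4, 5], [13, 6, 7, 4]]

/-- The map `T_{2,14}(3³, 4²)`. -/
def T_2_14 : Finset (Finset (Sym2 (Fin 14))) :=
  ofLists
    [[5, 4, 0], [5, 0, 6], [4, 13, 3], [4, 3, 0], [13, 7, 12], [13, 12, 3], [7, 1, 8],
      [7, 8, 12], [1, 2, 9], [1, 9, 8], [2, 11, 10], [2, 10, 9], [11, 5, 6], [11, 6, 10],
      [6, 0, 1, 7], [0, 3, 2, 1], [3, 12, 11, 2], [12, 8, 5, 11], [8, 9, 4, 5],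
      [9, 10, 13, 4], [10, 6, 7, 13]]

/-- The map `K_{1,10}(3³, 4²)`. -/
def K_1_10 : Finset (Finset (Sym2 (Fin 10))) :=
  ofLists
    [[5, 6, 0], [4, 0, 3], [6, 3, 5], [5, 4, 0], [4, 6, 3], [8, 7, 1], [9, 1, 2],
      [7, 2, 8], [8, 9, 1], [9, 7, 2], [8, 9, 4, 5], [9, 7, 6, 4], [6, 0, 1, 7],
      [0, 3, 2, 1], [3, 5, 8, 2]]

/-- The map `K_{1,12}(3³, 4²)`. -/
def K_1_12 : Finset (Finset (Sym2 (Fin 12))) :=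
  ofLists
    [[10, 9, 2], [10, 2, 6], [9, 8, 1], [9, 1, 2], [8, 11, 7], [8, 7, 1], [7, 3, 11],
      [3, 4, 11], [3, 0, 4], [0, 5, 4], [0, 6, 5], [6, 10, 5], [11, 4, 9, 10],
      [4, 5, 8, 9], [5, 10, 11, 8], [6, 2, 3, 7], [2, 1, 0, 3], [1, 7, 6, 0]]

/-- The map `K_{2,12}(3³, 4²)`. -/
def K_2_12 : Finset (Finset (Sym2 (Fin 12))) :=
  ofLists
    [[11, 5, 6], [5, 0, 6], [5, 4, 0], [4, 3, 0], [4, 11, 3], [11, 6, 3], [7, 1, 8],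
      [1, 9, 8], [1, 2, 9], [2, 10, 9], [2, 7, 10], [7, 8, 10], [6, 0, 1, 7], [0, 3, 2, 1],
      [3, 6, 7, 2], [8, 9, 5, 4], [9, 10, 11, 5], [10, 8, 4, 11]]

/-- The map `K_{1,14}(3³, 4²)`. -/
def K_1_14 : Finset (Finset (Sym2 (Fin 14))) :=
  ofLists
    [[5, 6, 0], [4, 0, 3], [13, 3, 12], [6, 12, 5], [5, 4, 0], [4, 13, 3], [13, 6, 12],
      [8, 7, 1], [9, 1, 2], [10, 2, 11], [7, 11, 8], [8, 9, 1], [9, 10, 2], [10, 7, 11],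
      [6, 0, 1, 7], [0, 3, 2, 1], [3, 12, 11, 2], [12, 5, 8, 11], [8, 9, 4, 5],
      [9, 10, 13, 4], [10, 7, 6, 13]]

/-- The map `K_{1,12}(3², 4, 3, 4)`. -/
def K_1_12_snub : Finset (Finset (Sym2 (Fin 12))) :=
  ofLists
    [[5, 8, 4], [5, 4, 0], [9, 6, 7], [9, 7, 11], [7, 0, 1], [0, 2, 1], [4, 11, 3],
      [11, 10, 3], [2, 3, 8], [2, 8, 9], [10, 1, 6], [10, 6, 5], [6, 5, 0, 7],
      [8, 9, 11, 4], [0, 4, 3, 2], [11, 7, 1, 10], [1, 2, 9, 6], [3, 10, 5, 8]]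

end SemiEquivelar

open SemiEquivelar

namespace SemiEquivelar
open Finset

/-! ### Cycles as edge sets: images under maps, cardinality, short cycles. -/

section Cycles

variable {V W : Type*} [DecidableEq V] [DecidableEq W]

/-! Call a vertex of a quadrangle, together with that quadrangle, a corner. In both types every
vertex lies on exactly two quadrangles, so a map with at most 15 vertices has at most 30 corners and
hence at most seven quadrangles. The map can be recovered from how its corners are glued.

In each type the local picture selects, at each corner, one edge of the quadrangle, and this makes a
group of order four act simply transitively on the corners of a quadrangle. For `(3³, 4²)` it is the
Klein group, generated by the two reflections that preserve the pair of edges lying in triangles.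
For `(3², 4, 3, 4)` it is cyclic: the selected edges orient the quadrangle. The triangles add one
fixed-point-free involution `tau` on the corners. Vertices and faces are then given by words in the
group and `tau` (`Realization`), and the closed cycle of faces around a vertex imposes relations
between such words, as well as inequalities between words that lead to different vertices.

Classifying the maps thus means listing all such involutions on at most seven blocks of four
corners. `Scheme.search` does this by backtracking: the first unmatched corner is matched either
with a corner already numbered or with one in a new block, values forced by the relations are filled
in, and tables that violate an inequality are dropped. `Gluing.exists_of_search` shows that one
branch follows any actual gluing. Connectedness of the carrier implies that a complete table
exhausts the map (`Realization.mem_of_closed`), and `Realization.iso_of_isLabelling` turns a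
labelling of the table by the vertices of a listed map into an isomorphism. The search itself is
evaluated by the kernel.

Conversely, the polyhedral conditions are local: `isSEM_of_hasWheel` derives them from a model of
the faces around one vertex, so each listed map is checked vertex by vertex. -/

theorem cycleEdges_map (f : V → W) (l : List V) :
    cycleEdges (l.map f) = (cycleEdges l).image (Sym2.map f) := by
  ext e
  simp only [cycleEdges, ← List.map_rotate, List.zipWith_map, mem_image, List.mem_toFinset]
  rw [← List.mem_map, List.map_zipWith]
  simp

theorem verts_image (f : V → W) (C : Finset (Sym2 V)) :
    verts (C.image (Sym2.map f)) = (verts C).image f := by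
  ext w
  simp only [verts, mem_biUnion, mem_image, Sym2.mem_toFinset]
  constructor
  · rintro ⟨_, ⟨e, he, rfl⟩, hw⟩
    obtain ⟨v, hv, rfl⟩ := Sym2.mem_map.1 hw
    exact ⟨v, ⟨e, he, hv⟩, rfl⟩
  · rintro ⟨v, ⟨e, he, hv⟩, rfl⟩
    exact ⟨_, ⟨e, he, rfl⟩, Sym2.mem_map.2 ⟨v, hv, rfl⟩⟩

theorem mem_verts {C : Finset (Sym2 V)} {v : V} : v ∈ verts C ↔ ∃ e ∈ C, v ∈ e := by
  simp [verts]

theorem cycleEdges_three (a b c : V) : cycleEdges [a, b, c] = {s(a, b), s(b, c), s(c, a)} := by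
  ext e
  simp [cycleEdges]

theorem cycleEdges_four (a b c d : V) :
    cycleEdges [a, b, c, d] = {s(a, b), s(b, c), s(c, d), s(d, a)} := by
  ext e
  simp [cycleEdges]

theorem verts_cycleEdges {l : List V} : verts (cycleEdges l) = l.toFinset := by
  ext v
  simp only [mem_verts, cycleEdges, List.mem_toFinset]
  constructor
  · rintro ⟨e, he, hv⟩
    obtain ⟨i, hi, rfl⟩ := List.mem_iff_getElem.1 he
    simp only [List.getElem_zipWith, Sym2.mem_iff] at hv
    rcases hv with rfl | rfl
    · exact List.getElem_mem _
    · exact List.mem_rotate.1 (List.getElem_mem _)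
  · intro hv
    obtain ⟨i, hi, rfl⟩ := List.mem_iff_getElem.1 hv
    refine ⟨_, List.mem_iff_getElem.2 ⟨i, by simpa using hi, rfl⟩, ?_⟩
    simp

/-- The only possible coincidence of two edges at different positions is a reversed one, which would
make each of two positions the cyclic successor of the other; this needs a list of length at most
two. -/
theorem card_cycleEdges {l : List V} (hl : l.Nodup) (h3 : 3 ≤ l.length) :
    (cycleEdges l).card = l.length := by
  rw [cycleEdges, List.toFinset_card_of_nodup]
  · simp
  rw [List.nodup_iff_injective_get]
  rintro ⟨i, hi⟩ ⟨j, hj⟩ h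
  simp only [List.length_zipWith, List.length_rotate, min_self] at hi hj
  simp only [List.get_eq_getElem, List.getElem_zipWith, List.getElem_rotate, Sym2.eq_iff,
    hl.getElem_inj_iff] at h
  simp only [Fin.mk.injEq]
  rcases h with h | ⟨h, h'⟩
  · exact h.1
  · rcases Nat.lt_or_ge (i + 1) l.length with h1 | h1 <;>
      rcases Nat.lt_or_ge (j + 1) l.length with h2 | h2
    · rw [Nat.mod_eq_of_lt h1] at h'
      rw [Nat.mod_eq_of_lt h2] at h
      omega
    · rw [show j + 1 = l.length by omega, Nat.mod_self] at h
      rw [Nat.mod_eq_of_lt h1] at h'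
      omega
    · rw [show i + 1 = l.length by omega, Nat.mod_self] at h'
      rw [Nat.mod_eq_of_lt h2] at h
      omega
    · omega

theorem IsCycle.not_isDiag {C : Finset (Sym2 V)} (hC : IsCycle C) {e : Sym2 V} (he : e ∈ C) :
    ¬ e.IsDiag := by
  obtain ⟨l, hl, h3, rfl⟩ := hC
  obtain ⟨i, hi, rfl⟩ := List.mem_iff_getElem.1 (List.mem_toFinset.1 he)
  simp only [List.length_zipWith, List.length_rotate, min_self] at hi
  simp only [List.getElem_zipWith, List.getElem_rotate, Sym2.mk_isDiag_iff,
    hl.getElem_inj_iff]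
  rcases Nat.lt_or_ge (i + 1) l.length with h1 | h1
  · rw [Nat.mod_eq_of_lt h1]; omega
  · rw [show i + 1 = l.length by omega, Nat.mod_self]; omega

theorem cycleEdges_three_rotate (a b c : V) : cycleEdges [a, b, c] = cycleEdges [b, c, a] := by
  ext; simp only [cycleEdges_three, mem_insert, mem_singleton]; tauto

theorem cycleEdges_three_swap (a b c : V) : cycleEdges [a, b, c] = cycleEdges [a, c, b] := by
  rw [cycleEdges_three, cycleEdges_three, Sym2.eq_swap (a := a) (b := c),
    Sym2.eq_swap (a := c) (b := b), Sym2.eq_swap (a := b) (b := a)]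
  ext; simp only [mem_insert, mem_singleton]; tauto

theorem cycleEdges_four_rotate (a b c d : V) :
    cycleEdges [a, b, c, d] = cycleEdges [b, c, d, a] := by
  ext; simp only [cycleEdges_four, mem_insert, mem_singleton]; tauto

theorem cycleEdges_four_swap (a b c d : V) :
    cycleEdges [a, b, c, d] = cycleEdges [a, d, c, b] := by
  rw [cycleEdges_four, cycleEdges_four, Sym2.eq_swap (a := a) (b := d),
    Sym2.eq_swap (a := d) (b := c), Sym2.eq_swap (a := c) (b := b), Sym2.eq_swap (a := b) (b := a)]
  ext; simp only [mem_insert, mem_singleton]; tauto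

/-- A cycle of length three through the edges `va`, `vb`. -/
theorem IsCycle.eq_three {C : Finset (Sym2 V)} (hC : IsCycle C) (h : C.card = 3) {v a b : V}
    (ha : s(v, a) ∈ C) (hb : s(v, b) ∈ C) (hab : a ≠ b) : C = cycleEdges [v, a, b] := by
  obtain ⟨l, hl, h3, rfl⟩ := hC
  rw [card_cycleEdges hl h3] at h
  match l, h with
  | [x, y, z], _ =>
    simp only [cycleEdges_three, mem_insert, mem_singleton, Sym2.eq_iff] at ha hb
    have h1 := cycleEdges_three_swap (V := V)
    have h2 := cycleEdges_three_rotate (V := V)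
    grind

/-- A cycle of length four through the edges `va`, `vb`. -/
theorem IsCycle.eq_four {C : Finset (Sym2 V)} (hC : IsCycle C) (h : C.card = 4) {v a b : V}
    (ha : s(v, a) ∈ C) (hb : s(v, b) ∈ C) (hab : a ≠ b) :
    ∃ z, [v, a, z, b].Nodup ∧ C = cycleEdges [v, a, z, b] := by
  obtain ⟨l, hl, h3, rfl⟩ := hC
  rw [card_cycleEdges hl h3] at h
  match l, h with
  | [x, y, z, w], _ =>
    -- Once the list is rotated to begin at `v`, only the direction of traversal remains
    -- undetermined.
    have key : ∀ y z w, [v, y, z, w].Nodup → s(v, a) ∈ cycleEdges [v, y, z, w] →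
        s(v, b) ∈ cycleEdges [v, y, z, w] → ∃ t, [v, a, t, b].Nodup ∧
          cycleEdges [v, y, z, w] = cycleEdges [v, a, t, b] := by
      intro y z w hn ha hb
      simp only [cycleEdges_four, mem_insert, mem_singleton, Sym2.eq_iff, List.nodup_cons,
        List.mem_cons, List.not_mem_nil, or_false, not_or] at ha hb hn
      rcases (by grind : (a = y ∧ b = w) ∨ (a = w ∧ b = y)) with ⟨rfl, rfl⟩ | ⟨rfl, rfl⟩
      · exact ⟨z, by grind, rfl⟩
      · exact ⟨z, by grind, cycleEdges_four_swap ..⟩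
    have hv : v ∈ ([x, y, z, w] : List V).toFinset := by
      rw [← verts_cycleEdges]
      exact mem_verts.2 ⟨_, ha, Sym2.mem_mk_left _ _⟩
    have h1 := cycleEdges_four_rotate (V := V)
    simp only [List.toFinset_cons, mem_insert, List.toFinset_nil, notMem_empty, or_false] at hv
    rcases hv with rfl | rfl | rfl | rfl
    · exact key _ _ _ hl ha hb
    · rw [h1] at ha hb ⊢
      exact key _ _ _ (by grind) ha hb
    · rw [h1, h1] at ha hb ⊢
      exact key _ _ _ (by grind) ha hb
    · rw [h1, h1, h1] at ha hb ⊢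
      exact key _ _ _ (by grind) ha hb

theorem cycleEdges_three_inj {v a b c d : V} (h : [v, a, b].Nodup)
    (h' : cycleEdges [v, a, b] = cycleEdges [v, c, d]) : (a = c ∧ b = d) ∨ (a = d ∧ b = c) := by
  have h1 := Finset.ext_iff.1 h' s(v, a)
  have h2 := Finset.ext_iff.1 h' s(v, b)
  simp [cycleEdges_three] at h h1 h2
  grind

theorem cycleEdges_four_inj {v a b c a' b' c' : V} (h : [v, a, b, c].Nodup)
    (hn : [v, a', b', c'].Nodup)
    (h' : cycleEdges [v, a, b, c] = cycleEdges [v, a', b', c']) :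
    (a = a' ∧ b = b' ∧ c = c') ∨ (a = c' ∧ b = b' ∧ c = a') := by
  have h1 := Finset.ext_iff.1 h' s(v, a)
  have h2 := Finset.ext_iff.1 h' s(v, c)
  have h3 := Finset.ext_iff.1 h' s(a, b)
  have h4 := Finset.ext_iff.1 h' s(b, c)
  simp [cycleEdges_four] at h hn h1 h2 h3 h4
  grind

end Cycles

/-! ### Connectedness of the carrier in terms of chains of faces. -/

section Carrier

variable {V : Type*} [DecidableEq V]

/-- The vertex `v` as a point of the space that contains the carriers. -/
def vertexPoint (v : V) : V ⊕ Finset (Sym2 V) → ℝ := Pi.single (Sum.inl v) 1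

/-- The apex of the cone that realises the face `C`. -/
def apexPoint (C : Finset (Sym2 V)) : V ⊕ Finset (Sym2 V) → ℝ := Pi.single (Sum.inr C) 1

/-- The triangle spanned by the edge `e` and the apex of `C`. -/
def coneTriangle (C : Finset (Sym2 V)) (e : Sym2 V) : Set (V ⊕ Finset (Sym2 V) → ℝ) :=
  convexHull ℝ (insert (apexPoint C) (vertexPoint '' {v | v ∈ e}))

theorem mem_carrier {K : Finset (Finset (Sym2 V))} {x : V ⊕ Finset (Sym2 V) → ℝ} :
    x ∈ carrier K ↔ ∃ C ∈ K, ∃ e ∈ C, x ∈ coneTriangle C e := by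
  simp only [carrier, Set.mem_iUnion, exists_prop]
  rfl

theorem vertexPoint_mem_coneTriangle {C : Finset (Sym2 V)} {e : Sym2 V} {v : V} (hv : v ∈ e) :
    vertexPoint v ∈ coneTriangle C e :=
  subset_convexHull _ _ (Set.mem_insert_of_mem _ ⟨v, hv, rfl⟩)

theorem apexPoint_mem_coneTriangle {C : Finset (Sym2 V)} {e : Sym2 V} :
    apexPoint C ∈ coneTriangle C e :=
  subset_convexHull _ _ (Set.mem_insert _ _)

/-- In a complex with connected carrier, any two vertices are linked by a chain of faces. -/
theorem mem_of_isConnected_carrier [Fintype V] {K : Finset (Finset (Sym2 V))}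
    (hcov : ∀ v : V, ∃ C ∈ K, v ∈ verts C) (hK : IsConnected (carrier K)) {A : Set V}
    (hA : A.Nonempty) (hcl : ∀ C ∈ K, ∀ v ∈ verts C, ∀ w ∈ verts C, v ∈ A → w ∈ A) (w : V) :
    w ∈ A := by
  classical
  by_contra hw
  -- The sum of the coordinates in `I` is 1 at the vertices of `A` and at the apexes of faces
  -- meeting `A`, and 0 at all other vertices and apexes. A face with a vertex in `A` has all of
  -- them there, so the sum is constant, 0 or 1, on each cone triangle and cannot take the value 1/2
  -- on the carrier.
  let I : Finset (V ⊕ Finset (Sym2 V)) :=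
    univ.filter (Sum.elim (· ∈ A) fun C => ∃ v ∈ verts C, v ∈ A)
  let φ : (V ⊕ Finset (Sym2 V) → ℝ) →ₗ[ℝ] ℝ := ∑ i ∈ I, LinearMap.proj i
  have hφ : ∀ x, φ x = ∑ i ∈ I, x i := fun x => by simp [φ]
  have hs : ∀ j, φ (Pi.single j 1) = if j ∈ I then 1 else 0 := fun j => by
    simp [hφ, Pi.single_apply]
  have hcont : Continuous φ := by
    have : (φ : (V ⊕ Finset (Sym2 V) → ℝ) → ℝ) = fun x => ∑ i ∈ I, x i := funext hφ
    rw [this]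
    fun_prop
  have hvert : ∀ v, φ (vertexPoint v) = if v ∈ A then 1 else 0 := fun v => by
    simp [vertexPoint, hs, I]
  have hval : ∀ x ∈ carrier K, φ x = 0 ∨ φ x = 1 := by
    intro x hx
    obtain ⟨C, hC, e, he, hx⟩ := mem_carrier.1 hx
    by_cases h : ∃ v ∈ verts C, v ∈ A
    · right
      have : coneTriangle C e ⊆ φ ⁻¹' {1} := by
        refine convexHull_min ?_ ((convex_singleton _).linear_preimage φ)
        rintro _ (rfl | ⟨v, hv, rfl⟩)
        · simp [apexPoint, hs, I, h]
        · obtain ⟨u, hu, huA⟩ := h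
          simp [hvert, hcl C hC u hu v (mem_verts.2 ⟨e, he, hv⟩) huA]
      exact this hx
    · left
      have : coneTriangle C e ⊆ φ ⁻¹' {0} := by
        refine convexHull_min ?_ ((convex_singleton _).linear_preimage φ)
        rintro _ (rfl | ⟨v, hv, rfl⟩)
        · simp only [Set.mem_preimage, Set.mem_singleton_iff, apexPoint, hs]
          rw [if_neg]
          simpa [I] using h
        · have : v ∉ A := fun hvA => h ⟨v, mem_verts.2 ⟨e, he, hv⟩, hvA⟩
          simp [hvert, this]
      exact this hx
  have hmem : ∀ v, vertexPoint v ∈ carrier K := fun v => by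
    obtain ⟨C, hC, hv⟩ := hcov v
    obtain ⟨e, he, hve⟩ := mem_verts.1 hv
    exact mem_carrier.2 ⟨C, hC, e, he, vertexPoint_mem_coneTriangle hve⟩
  obtain ⟨v, hv⟩ := hA
  have := hK.isPreconnected.intermediate_value (hmem w) (hmem v) hcont.continuousOn
  rw [hvert, hvert, if_pos hv, if_neg hw] at this
  obtain ⟨x, hx, hx'⟩ := this (show (1 / 2 : ℝ) ∈ Set.Icc 0 1 by norm_num)
  rcases hval x hx with h | h <;> rw [h] at hx' <;> norm_num at hx'

/-- If all vertices are linked to `v₀` by chains of faces, then the carrier is connected. -/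
theorem isConnected_carrier {K : Finset (Finset (Sym2 V))} (v₀ : V)
    (hcov : ∃ C ∈ K, v₀ ∈ verts C)
    (h : ∀ A : Set V, v₀ ∈ A → (∀ C ∈ K, ∀ v ∈ verts C, ∀ w ∈ verts C, v ∈ A → w ∈ A) →
      ∀ w, w ∈ A) : IsConnected (carrier K) := by
  have hjoin : ∀ C ∈ K, ∀ e ∈ C, ∀ x ∈ coneTriangle C e, ∀ y ∈ coneTriangle C e,
      JoinedIn (carrier K) x y := fun C hC e he x hx y hy =>
    JoinedIn.of_segment_subset (((convex_convexHull _ _).segment_subset hx hy).trans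
      fun z hz => mem_carrier.2 ⟨C, hC, e, he, hz⟩)
  have hbase : vertexPoint v₀ ∈ carrier K := by
    obtain ⟨C, hC, hv⟩ := hcov
    obtain ⟨e, he, hve⟩ := mem_verts.1 hv
    exact mem_carrier.2 ⟨C, hC, e, he, vertexPoint_mem_coneTriangle hve⟩
  -- Two vertices of one face are joined through its apex, which is common to all its cone
  -- triangles.
  have hvert := h {v | JoinedIn (carrier K) (vertexPoint v₀) (vertexPoint v)}
    (JoinedIn.refl hbase) (by
      intro C hC v hv w hw hj
      obtain ⟨e, he, hve⟩ := mem_verts.1 hv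
      obtain ⟨e', he', hwe⟩ := mem_verts.1 hw
      exact (hj.trans (hjoin C hC e he _ (vertexPoint_mem_coneTriangle hve) _
        apexPoint_mem_coneTriangle)).trans (hjoin C hC e' he' _ apexPoint_mem_coneTriangle _
        (vertexPoint_mem_coneTriangle hwe)))
  refine IsPathConnected.isConnected ⟨vertexPoint v₀, hbase, fun {x} hx => ?_⟩
  obtain ⟨C, hC, e, he, hx⟩ := mem_carrier.1 hx
  obtain ⟨v, hv⟩ : ∃ v, v ∈ e := ⟨_, e.out_fst_mem⟩
  exact (hvert v).trans (hjoin C hC e he _ (vertexPoint_mem_coneTriangle hv) _ hx)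

end Carrier

/-! ### The faces around a vertex and their model on eight points. -/

theorem injective_vec8 {V : Type*} {v a b c d e y z : V} (h : [v, a, b, c, d, e, y, z].Nodup) :
    Function.Injective ![v, a, b, c, d, e, y, z] := by
  have : ![v, a, b, c, d, e, y, z] = [v, a, b, c, d, e, y, z].get := by
    funext i; fin_cases i <;> rfl
  rw [this]
  exact List.nodup_iff_injective_get.1 h

section Wheels

variable {V : Type*} [DecidableEq V]

/-- The faces around the vertex `0` in a map of type `(3³, 4²)`: the neighbours of `0` are
`1, …, 5`, and `6`, `7` are the vertices opposite to `0` in the quadrangles. -/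
def wheel33344 : List (List (Fin 8)) :=
  [[0, 5, 1], [0, 1, 2], [0, 2, 3], [0, 3, 6, 4], [0, 4, 7, 5]]

/-- The faces around the vertex `0` in a map of type `(3², 4, 3, 4)`. -/
def wheel33434 : List (List (Fin 8)) :=
  [[0, 5, 1], [0, 1, 2], [0, 2, 6, 3], [0, 3, 4], [0, 4, 7, 5]]

/-- The faces of `K` that contain `v` form a copy of the wheel `w`. -/
def HasWheel (K : Finset (Finset (Sym2 V))) (w : List (List (Fin 8))) (v : V) : Prop :=
  ∃ f : Fin 8 → V, Function.Injective f ∧ f 0 = v ∧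
    ∀ C, (C ∈ K ∧ v ∈ verts C) ↔ ∃ l ∈ w, C = cycleEdges (l.map f)

/-- The type is prescribed only up to rotation, so the list of faces and that of common edges are
rotated together until the sizes appear in the given order. -/
theorem IsFaceCycle.five {K : Finset (Finset (Sym2 V))} {v : V} {a₁ a₂ a₃ a₄ a₅ : ℕ}
    (h : HasFaceSequence K v [a₁, a₂, a₃, a₄, a₅]) :
    ∃ C₁ C₂ C₃ C₄ C₅ e₁ e₂ e₃ e₄ e₅, [C₁, C₂, C₃, C₄, C₅].Nodup ∧ [e₁, e₂, e₃, e₄, e₅].Nodup ∧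
      (∀ C, C ∈ [C₁, C₂, C₃, C₄, C₅] ↔ C ∈ K ∧ v ∈ verts C) ∧
      (MeetInEdge C₁ C₂ e₁ ∧ MeetInEdge C₂ C₃ e₂ ∧ MeetInEdge C₃ C₄ e₃ ∧ MeetInEdge C₄ C₅ e₄ ∧
        MeetInEdge C₅ C₁ e₅) ∧
      C₁.card = a₁ ∧ C₂.card = a₂ ∧ C₃.card = a₃ ∧ C₄.card = a₄ ∧ C₅.card = a₅ := by
  obtain ⟨L, ⟨-, hnd, hmem, E, hE, hF⟩, hrot⟩ := h
  have hlen : L.length = 5 := by simpa using hrot.perm.length_eq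
  have hElen : E.length = 5 := by simpa [hlen] using hF.length_eq.symm
  match L, hlen, E, hElen with
  | [C₁, C₂, C₃, C₄, C₅], _, [e₁, e₂, e₃, e₄, e₅], _ =>
    obtain ⟨n, hn, hrot⟩ := List.isRotated_iff_mod.1 hrot
    simp only [List.rotate_cons_succ, List.rotate_zero, List.cons_append, List.nil_append,
      List.zip_cons_cons, List.zip_nil_right, List.forall₂_cons, List.forall₂_nil_left_iff,
      and_true] at hF
    obtain ⟨h₁, h₂, h₃, h₄, h₅⟩ := hF
    simp only [List.map_cons, List.map_nil, List.length_cons, List.length_nil] at hrot hn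
    -- The bound on `n` is the length itself, so the full rotation by 5 occurs besides the trivial
    -- one.
    have hn' : n = 0 ∨ n = 1 ∨ n = 2 ∨ n = 3 ∨ n = 4 ∨ n = 5 := by omega
    rcases hn' with rfl | rfl | rfl | rfl | rfl | rfl <;>
      simp only [List.rotate_cons_succ, List.rotate_zero, List.cons_append, List.nil_append,
        List.cons.injEq, and_true] at hrot <;> obtain ⟨r₁, r₂, r₃, r₄, r₅⟩ := hrot
    · exact ⟨C₁, C₂, C₃, C₄, C₅, e₁, e₂, e₃, e₄, e₅, hnd, hE, hmem, ⟨h₁, h₂, h₃, h₄, h₅⟩,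
        r₁, r₂, r₃, r₄, r₅⟩
    · exact ⟨C₂, C₃, C₄, C₅, C₁, e₂, e₃, e₄, e₅, e₁, by grind, by grind, by grind,
        ⟨h₂, h₃, h₄, h₅, h₁⟩, r₁, r₂, r₃, r₄, r₅⟩
    · exact ⟨C₃, C₄, C₅, C₁, C₂, e₃, e₄, e₅, e₁, e₂, by grind, by grind, by grind,
        ⟨h₃, h₄, h₅, h₁, h₂⟩, r₁, r₂, r₃, r₄, r₅⟩
    · exact ⟨C₄, C₅, C₁, C₂, C₃, e₄, e₅, e₁, e₂, e₃, by grind, by grind, by grind,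
        ⟨h₄, h₅, h₁, h₂, h₃⟩, r₁, r₂, r₃, r₄, r₅⟩
    · exact ⟨C₅, C₁, C₂, C₃, C₄, e₅, e₁, e₂, e₃, e₄, by grind, by grind, by grind,
        ⟨h₅, h₁, h₂, h₃, h₄⟩, r₁, r₂, r₃, r₄, r₅⟩
    · exact ⟨C₁, C₂, C₃, C₄, C₅, e₁, e₂, e₃, e₄, e₅, hnd, hE, hmem, ⟨h₁, h₂, h₃, h₄, h₅⟩,
        r₁, r₂, r₃, r₄, r₅⟩

theorem MeetInEdge.exists_eq {C D : Finset (Sym2 V)} {e : Sym2 V} {v : V} (h : MeetInEdge C D e)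
    (hC : v ∈ verts C) (hD : v ∈ verts D) : ∃ u, e = s(v, u) ∧ s(v, u) ∈ C ∧ s(v, u) ∈ D := by
  have hv : v ∈ e := by
    rw [← Sym2.mem_toFinset, ← h.2]
    exact mem_inter.2 ⟨hC, hD⟩
  obtain ⟨u, rfl⟩ := hv
  have : s(v, u) ∈ C ∩ D := by rw [h.1]; exact mem_singleton_self _
  exact ⟨u, rfl, mem_inter.1 this⟩

/-- The vertices of an edge of one face that both lie on another face span an edge. -/
theorem IsPolyhedralComplex.edge_mem {K : Finset (Finset (Sym2 V))} (hK : IsPolyhedralComplex K)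
    {C D : Finset (Sym2 V)} (hC : C ∈ K) (hD : D ∈ K) (hCD : C ≠ D) {a b : V} (hab : a ≠ b)
    (haC : a ∈ verts C) (haD : a ∈ verts D) (hbC : b ∈ verts C) (hbD : b ∈ verts D) :
    s(a, b) ∈ C := by
  have ha := mem_inter.2 ⟨haC, haD⟩
  have hb := mem_inter.2 ⟨hbC, hbD⟩
  rcases hK.inter C hC D hD hCD with h | ⟨v, h⟩ | ⟨e, h, h'⟩
  · simp [h] at ha
  · rw [h, mem_singleton] at ha hb
    exact absurd (ha.trans hb.symm) hab
  · rw [h', Sym2.mem_toFinset] at ha hb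
    rw [← (Sym2.mem_and_mem_iff hab).1 ⟨ha, hb⟩]
    exact (mem_inter.1 (h ▸ mem_singleton_self e)).1

/-- Two faces sharing both `v` and `z` would share an edge `vz`, but `vz` is a diagonal of the
quadrangle. -/
theorem IsPolyhedralComplex.opposite_notMem {K : Finset (Finset (Sym2 V))}
    (hK : IsPolyhedralComplex K) {v a z b : V} (hn : [v, a, z, b].Nodup)
    (hC : cycleEdges [v, a, z, b] ∈ K) {D : Finset (Sym2 V)} (hD : D ∈ K)
    (hCD : cycleEdges [v, a, z, b] ≠ D) (hv : v ∈ verts D) : z ∉ verts D := by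
  intro hz
  have hvz : v ≠ z := by grind
  have := hK.edge_mem hC hD hCD hvz (by simp [verts_cycleEdges]) hv (by simp [verts_cycleEdges]) hz
  simp only [cycleEdges_four, mem_insert, mem_singleton, Sym2.eq_iff, List.nodup_cons,
    List.mem_cons, List.not_mem_nil, or_false, not_or] at this hn
  grind

/-- The five common edges of consecutive faces supply the neighbours of `v`; they fix the triangles,
and each quadrangle adds one opposite vertex. The opposite vertices differ from everything else
because, by `opposite_notMem`, neither lies on another face at `v`. -/
theorem hasWheel_33344 {K : Finset (Finset (Sym2 V))} (hK : IsPolyhedralComplex K) {v : V}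
    (h : HasFaceSequence K v type33344) : HasWheel K wheel33344 v := by
  obtain ⟨C₁, C₂, C₃, C₄, C₅, e₁, e₂, e₃, e₄, e₅, hnd, hE, hmem, ⟨h₁, h₂, h₃, h₄, h₅⟩,
    r₁, r₂, r₃, r₄, r₅⟩ := IsFaceCycle.five h
  have m₁ := (hmem C₁).1 (by simp)
  have m₂ := (hmem C₂).1 (by simp)
  have m₃ := (hmem C₃).1 (by simp)
  have m₄ := (hmem C₄).1 (by simp)
  have m₅ := (hmem C₅).1 (by simp)
  obtain ⟨u₁, rfl, g₁, g₁'⟩ := h₁.exists_eq m₁.2 m₂.2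
  obtain ⟨u₂, rfl, g₂, g₂'⟩ := h₂.exists_eq m₂.2 m₃.2
  obtain ⟨u₃, rfl, g₃, g₃'⟩ := h₃.exists_eq m₃.2 m₄.2
  obtain ⟨u₄, rfl, g₄, g₄'⟩ := h₄.exists_eq m₄.2 m₅.2
  obtain ⟨u₅, rfl, g₅, g₅'⟩ := h₅.exists_eq m₅.2 m₁.2
  have n₁ := (hK.isCycle _ m₁.1).not_isDiag g₁
  have n₂ := (hK.isCycle _ m₂.1).not_isDiag g₂
  have n₃ := (hK.isCycle _ m₃.1).not_isDiag g₃
  have n₄ := (hK.isCycle _ m₄.1).not_isDiag g₄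
  have n₅ := (hK.isCycle _ m₅.1).not_isDiag g₅
  rw [Sym2.mk_isDiag_iff] at n₁ n₂ n₃ n₄ n₅
  simp only [List.nodup_cons, List.mem_cons, Sym2.congr_right, List.not_mem_nil, or_false,
    not_or, not_false_eq_true, List.nodup_nil, and_true] at hE hnd
  obtain ⟨⟨u12, u13, u14, u15⟩, ⟨u23, u24, u25⟩, ⟨u34, u35⟩, u45⟩ := hE
  obtain ⟨⟨c12, c13, c14, c15⟩, ⟨c23, c24, c25⟩, ⟨c34, c35⟩, c45⟩ := hnd
  have t₁ := (hK.isCycle _ m₁.1).eq_three r₁ g₅' g₁ (Ne.symm u15)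
  have t₂ := (hK.isCycle _ m₂.1).eq_three r₂ g₁' g₂ u12
  have t₃ := (hK.isCycle _ m₃.1).eq_three r₃ g₂' g₃ u23
  obtain ⟨z, hz, t₄⟩ := (hK.isCycle _ m₄.1).eq_four r₄ g₃' g₄ u34
  obtain ⟨y, hy, t₅⟩ := (hK.isCycle _ m₅.1).eq_four r₅ g₄' g₅ u45
  have o₄ := fun D hD hCD => hK.opposite_notMem (D := D) hz (t₄ ▸ m₄.1) hD (t₄ ▸ hCD)
  have o₅ := fun D hD hCD => hK.opposite_notMem (D := D) hy (t₅ ▸ m₅.1) hD (t₅ ▸ hCD)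
  have z1 : z ∉ verts C₁ := o₄ _ m₁.1 (Ne.symm c14) m₁.2
  have z2 : z ∉ verts C₂ := o₄ _ m₂.1 (Ne.symm c24) m₂.2
  have z5 : z ∉ verts C₅ := o₄ _ m₅.1 c45 m₅.2
  have y1 : y ∉ verts C₁ := o₅ _ m₁.1 (Ne.symm c15) m₁.2
  have y2 : y ∉ verts C₂ := o₅ _ m₂.1 (Ne.symm c25) m₂.2
  have y3 : y ∉ verts C₃ := o₅ _ m₃.1 (Ne.symm c35) m₃.2
  rw [t₁, verts_cycleEdges] at z1 y1
  rw [t₂, verts_cycleEdges] at z2 y2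
  rw [t₃, verts_cycleEdges] at y3
  rw [t₅, verts_cycleEdges] at z5
  refine ⟨![v, u₁, u₂, u₃, u₄, u₅, z, y], injective_vec8 ?_, rfl, fun C => ?_⟩
  · simp only [List.toFinset_cons, List.toFinset_nil, mem_insert, notMem_empty, or_false, not_or,
      List.nodup_cons, List.mem_cons, List.not_mem_nil] at *
    grind
  · rw [← hmem, t₁, t₂, t₃, t₄, t₅]
    simp [wheel33344]

theorem hasWheel_33434 {K : Finset (Finset (Sym2 V))} (hK : IsPolyhedralComplex K) {v : V}
    (h : HasFaceSequence K v type33434) : HasWheel K wheel33434 v := by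
  obtain ⟨C₁, C₂, C₃, C₄, C₅, e₁, e₂, e₃, e₄, e₅, hnd, hE, hmem, ⟨h₁, h₂, h₃, h₄, h₅⟩,
    r₁, r₂, r₃, r₄, r₅⟩ := IsFaceCycle.five h
  have m₁ := (hmem C₁).1 (by simp)
  have m₂ := (hmem C₂).1 (by simp)
  have m₃ := (hmem C₃).1 (by simp)
  have m₄ := (hmem C₄).1 (by simp)
  have m₅ := (hmem C₅).1 (by simp)
  obtain ⟨u₁, rfl, g₁, g₁'⟩ := h₁.exists_eq m₁.2 m₂.2
  obtain ⟨u₂, rfl, g₂, g₂'⟩ := h₂.exists_eq m₂.2 m₃.2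
  obtain ⟨u₃, rfl, g₃, g₃'⟩ := h₃.exists_eq m₃.2 m₄.2
  obtain ⟨u₄, rfl, g₄, g₄'⟩ := h₄.exists_eq m₄.2 m₅.2
  obtain ⟨u₅, rfl, g₅, g₅'⟩ := h₅.exists_eq m₅.2 m₁.2
  have n₁ := (hK.isCycle _ m₁.1).not_isDiag g₁
  have n₂ := (hK.isCycle _ m₂.1).not_isDiag g₂
  have n₃ := (hK.isCycle _ m₃.1).not_isDiag g₃
  have n₄ := (hK.isCycle _ m₄.1).not_isDiag g₄
  have n₅ := (hK.isCycle _ m₅.1).not_isDiag g₅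
  rw [Sym2.mk_isDiag_iff] at n₁ n₂ n₃ n₄ n₅
  simp only [List.nodup_cons, List.mem_cons, Sym2.congr_right, List.not_mem_nil, or_false,
    not_or, not_false_eq_true, List.nodup_nil, and_true] at hE hnd
  obtain ⟨⟨u12, u13, u14, u15⟩, ⟨u23, u24, u25⟩, ⟨u34, u35⟩, u45⟩ := hE
  obtain ⟨⟨c12, c13, c14, c15⟩, ⟨c23, c24, c25⟩, ⟨c34, c35⟩, c45⟩ := hnd
  have t₁ := (hK.isCycle _ m₁.1).eq_three r₁ g₅' g₁ (Ne.symm u15)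
  have t₂ := (hK.isCycle _ m₂.1).eq_three r₂ g₁' g₂ u12
  obtain ⟨z, hz, t₃⟩ := (hK.isCycle _ m₃.1).eq_four r₃ g₂' g₃ u23
  have t₄ := (hK.isCycle _ m₄.1).eq_three r₄ g₃' g₄ u34
  obtain ⟨y, hy, t₅⟩ := (hK.isCycle _ m₅.1).eq_four r₅ g₄' g₅ u45
  have o₃ := fun D hD hCD => hK.opposite_notMem (D := D) hz (t₃ ▸ m₃.1) hD (t₃ ▸ hCD)
  have o₅ := fun D hD hCD => hK.opposite_notMem (D := D) hy (t₅ ▸ m₅.1) hD (t₅ ▸ hCD)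
  have z1 : z ∉ verts C₁ := o₃ _ m₁.1 (Ne.symm c13) m₁.2
  have z5 : z ∉ verts C₅ := o₃ _ m₅.1 c35 m₅.2
  have y2 : y ∉ verts C₂ := o₅ _ m₂.1 (Ne.symm c25) m₂.2
  have y3 : y ∉ verts C₃ := o₅ _ m₃.1 (Ne.symm c35) m₃.2
  rw [t₁, verts_cycleEdges] at z1
  rw [t₂, verts_cycleEdges] at y2
  rw [t₃, verts_cycleEdges] at y3
  rw [t₅, verts_cycleEdges] at z5
  refine ⟨![v, u₁, u₂, u₃, u₄, u₅, z, y], injective_vec8 ?_, rfl, fun C => ?_⟩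
  · simp only [List.toFinset_cons, List.toFinset_nil, mem_insert, notMem_empty, or_false, not_or,
      List.nodup_cons, List.mem_cons, List.not_mem_nil] at *
    grind
  · rw [← hmem, t₁, t₂, t₃, t₄, t₅]
    simp [wheel33434]

theorem MeetInEdge.image {W : Type*} [DecidableEq W] {f : V → W} (hf : Function.Injective f)
    {C D : Finset (Sym2 V)} {e : Sym2 V} (h : MeetInEdge C D e) :
    MeetInEdge (C.image (Sym2.map f)) (D.image (Sym2.map f)) (e.map f) := by
  constructor
  · rw [← image_inter _ _ (Sym2.map.injective hf), h.1, image_singleton]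
  · rw [verts_image, verts_image, ← image_inter _ _ hf, h.2]
    ext w
    simp [Sym2.mem_map]

/-- A combination of faces around every vertex into wheels makes a polyhedral complex. -/
theorem isSEM_of_hasWheel {K : Finset (Finset (Sym2 V))} {w : List (List (Fin 8))}
    {s : List ℕ} (hcyc : ∀ C ∈ K, IsCycle C) (hwheel : ∀ v, HasWheel K w v)
    (hconn : IsConnected (carrier K)) (h3 : 3 ≤ w.length)
    (hnd : (w.map cycleEdges).Nodup) (hs : w.map (fun l => (cycleEdges l).card) = s)
    (hinter : ∀ l ∈ w, ∀ l' ∈ w, l ≠ l' → verts (cycleEdges l) ∩ verts (cycleEdges l') = {0} ∨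
      ∃ e, MeetInEdge (cycleEdges l) (cycleEdges l') e)
    (hE : ∃ E : List (Sym2 (Fin 8)), E.Nodup ∧
      List.Forall₂ (fun p e => MeetInEdge (cycleEdges p.1) (cycleEdges p.2) e)
        (w.zip (w.rotate 1)) E) : IsSEM K s := by
  have hface : ∀ v, ∃ L, IsFaceCycle K v L ∧ L.map Finset.card = s := by
    intro v
    obtain ⟨f, hf, hf0, hC⟩ := hwheel v
    refine ⟨w.map fun l => cycleEdges (l.map f), ⟨by simpa using h3, ?_, fun C => ?_, ?_⟩, ?_⟩
    · have : (w.map fun l => cycleEdges (l.map f)) =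
          (w.map cycleEdges).map (Finset.image (Sym2.map f)) := by
        simp [cycleEdges_map]
      rw [this]
      exact hnd.map (Finset.image_injective (Sym2.map.injective hf))
    · rw [hC, List.mem_map]
      simp [eq_comm]
    · obtain ⟨E, hEn, hE⟩ := hE
      refine ⟨E.map (Sym2.map f), hEn.map (Sym2.map.injective hf), ?_⟩
      rw [← List.map_rotate, List.zip_map, List.forall₂_map_left_iff, List.forall₂_map_right_iff]
      refine hE.imp fun p e h => ?_
      simpa only [Prod.map_fst, Prod.map_snd, cycleEdges_map] using h.image hf
    · rw [← hs, List.map_map]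
      refine List.map_congr_left fun l _ => ?_
      simp only [Function.comp_apply, cycleEdges_map]
      exact card_image_of_injective _ (Sym2.map.injective hf)
  refine ⟨⟨⟨⟨hcyc, ?_, ?_⟩, ?_⟩, hconn⟩, ?_⟩
  · intro v
    obtain ⟨f, hf, hf0, hC⟩ := hwheel v
    match w, h3 with
    | l :: w, _ => exact ⟨_, (hC _).2 ⟨l, by simp, rfl⟩⟩
  · intro C hC D hD hCD
    by_cases h : verts C ∩ verts D = ∅
    · exact Or.inl h
    -- A common vertex puts both faces into one wheel, where their intersection is the injective
    -- image of one in the model.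
    obtain ⟨v, hv⟩ := nonempty_iff_ne_empty.2 h
    rw [mem_inter] at hv
    obtain ⟨f, hf, hf0, hfC⟩ := hwheel v
    obtain ⟨l, hl, rfl⟩ := (hfC C).1 ⟨hC, hv.1⟩
    obtain ⟨l', hl', rfl⟩ := (hfC D).1 ⟨hD, hv.2⟩
    simp only [cycleEdges_map]
    rcases hinter l hl l' hl' (by rintro rfl; exact hCD rfl) with h | ⟨e, h⟩
    · refine Or.inr (Or.inl ⟨f 0, ?_⟩)
      rw [verts_image, verts_image, ← image_inter _ _ hf, h, image_singleton]
    · exact Or.inr (Or.inr ⟨_, h.image hf⟩)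
  · intro v
    obtain ⟨L, hL, -⟩ := hface v
    exact ⟨L, hL⟩
  · intro v
    obtain ⟨L, hL, h⟩ := hface v
    exact ⟨L, hL, h ▸ List.IsRotated.refl _⟩

theorem isSEM_33344_of_hasWheel {K : Finset (Finset (Sym2 V))}
    (hcyc : ∀ C ∈ K, IsCycle C) (hwheel : ∀ v, HasWheel K wheel33344 v)
    (hconn : IsConnected (carrier K)) : IsSEM K type33344 := by
  refine isSEM_of_hasWheel hcyc hwheel hconn (by decide) (by decide) (by decide) ?_ ?_
  · simp only [MeetInEdge]; decide +kernel
  · refine ⟨[s(0, 1), s(0, 2), s(0, 3), s(0, 4), s(0, 5)], by decide, ?_⟩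
    simp only [MeetInEdge]; decide +kernel

theorem isSEM_33434_of_hasWheel {K : Finset (Finset (Sym2 V))}
    (hcyc : ∀ C ∈ K, IsCycle C) (hwheel : ∀ v, HasWheel K wheel33434 v)
    (hconn : IsConnected (carrier K)) : IsSEM K type33434 := by
  refine isSEM_of_hasWheel hcyc hwheel hconn (by decide) (by decide) (by decide) ?_ ?_
  · simp only [MeetInEdge]; decide +kernel
  · refine ⟨[s(0, 1), s(0, 2), s(0, 3), s(0, 4), s(0, 5)], by decide, ?_⟩
    simp only [MeetInEdge]; decide +kernel

end Wheels

/-! ### Gluing schemes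

The corners of the quadrangles of a map come in blocks of four, on each of which a group of order
four acts simply transitively; `S.op` describes this action: `S.op i j` is the place to which `j`
moves the place `i`. An involution `tau` of the corners glues the blocks together. A word is a list
of letters, where the letters below `4` stand for the elements of the group and `4` for `tau`. -/

/-- The combinatorial data on which a search for maps depends. -/
structure Scheme where
  /-- The action on a block. -/
  op : ℕ → ℕ → ℕ
  /-- Words that act as `tau`. -/
  forced : List (List ℕ)
  /-- Pairs of words that never send a corner to the same corner. -/
  distinct : List (List ℕ × List ℕ)
  /-- The word that leads to the other corner at the same vertex. -/
  mate : List ℕ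
  /-- The faces at a corner, their vertices being represented by corners. -/
  polygons : List (List (List ℕ))

/-- The group laws that a scheme has to satisfy. -/
structure Scheme.Lawful (S : Scheme) : Prop where
  op_lt : ∀ i < 4, ∀ j < 4, S.op i j < 4
  exists_inv : ∀ i < 4, ∃ j < 4, S.op i j = 0
  forced_le : ∀ w ∈ S.forced, ∀ l ∈ w, l ≤ 4
  distinct_le : ∀ p ∈ S.distinct, (∀ l ∈ p.1, l ≤ 4) ∧ ∀ l ∈ p.2, l ≤ 4
  mate_le : ∀ l ∈ S.mate, l ≤ 4
  polygons_le : ∀ p ∈ S.polygons, ∀ w ∈ p, ∀ l ∈ w, l ≤ 4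

/-- The effect of a word. -/
def evalWord {F : Type*} (act : ℕ → F → F) (tau : F → F) (w : List ℕ) (x : F) : F :=
  w.foldl (fun x l => if l = 4 then tau x else act l x) x

/-- A set of corners that are glued according to the scheme `S`. -/
structure Gluing (S : Scheme) (F : Type*) where
  act : ℕ → F → F
  tau : F → F
  act_zero : ∀ x, act 0 x = x
  act_act : ∀ i < 4, ∀ j < 4, ∀ x, act j (act i x) = act (S.op i j) x
  act_free : ∀ i < 4, ∀ j < 4, ∀ x, act i x = act j x → i = j
  tau_tau : ∀ x, tau (tau x) = x
  tau_ne : ∀ x, tau x ≠ x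
  forced : ∀ w ∈ S.forced, ∀ x, evalWord act tau w x = tau x
  distinct : ∀ p ∈ S.distinct, ∀ x, evalWord act tau p.1 x ≠ evalWord act tau p.2 x

/-! ### The search

A partial map `x ↦ y` on the numbers below `31` is coded by the number with digits `y + 1`
in base `32`. -/

namespace Scheme

/-- Application of a function, after evaluation of the argument. -/
def strictly {α : Type} (f : ℕ → α) : ℕ → α
  | 0 => f 0
  | m + 1 => f (m + 1)

/-- The digit of the table `t` at `x`: it is `0` where the table is undefined, and otherwise one
more than the value. -/
def entry (t x : ℕ) : ℕ := (t >>> (5 * x)) &&& 31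

/-- The table `t` with the additional value `y` at `x`. -/
def record (t x y : ℕ) : ℕ := t ||| ((y + 1) <<< (5 * x))

/-- Whether `p` holds below `n`. -/
def allBelow (p : ℕ → Bool) : ℕ → Bool
  | 0 => true
  | n + 1 => bif p n then allBelow p n else false

/-- The least of the numbers `x, …, x + m - 1` where `t` is undefined, or `x + m`. -/
def firstFree (t : ℕ) : ℕ → ℕ → ℕ
  | 0, x => x
  | m + 1, x => strictly (fun x => bif Nat.beq (entry t x) 0 then x else firstFree t m (x + 1)) x

variable (S : Scheme)

/-- The result of the word `w` at `a - 1`, increased by `1`, or `0` if it is undefined. -/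
def trace (t : ℕ) : List ℕ → ℕ → ℕ
  | [], a => a
  | l :: w, a =>
    match a with
    | 0 => 0
    | x + 1 => trace t w (bif Nat.beq l 4 then entry t x else x / 4 * 4 + S.op (x % 4) l + 1)

/-- The table `t` of the numbers below `n` does not contradict the requirement `S.distinct`. -/
def admissible (t n : ℕ) : Bool :=
  allBelow (fun x => S.distinct.all fun p =>
    match S.trace t p.1 (x + 1) with
    | 0 => true
    | a + 1 => !Nat.beq (S.trace t p.2 (x + 1)) (a + 1)) n

/-- One more than the value at `x` that is prescribed by `S.forced`, or `0`. -/
def forcedAt (t x : ℕ) : List (List ℕ) → ℕ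
  | [] => 0
  | w :: W =>
    match S.trace t w (x + 1) with
    | 0 => forcedAt t x W
    | y + 1 => y + 1

/-- The first undefined place `x` in `x, …, x + m - 1` with a prescribed value `y`, as
`32 * x + y + 1`, or `0`. -/
def nextForced (t : ℕ) : ℕ → ℕ → ℕ
  | 0, _ => 0
  | m + 1, x => strictly (fun x => bif Nat.beq (entry t x) 0 then
        match S.forcedAt t x S.forced with
        | 0 => nextForced t m (x + 1)
        | y + 1 => 32 * x + y + 1
      else nextForced t m (x + 1)) x

/-- Whether all complete tables with at most seven blocks that extend the table `t` for `k` blocks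
fulfil the requirement `chk`. -/
def search (chk : ℕ → ℕ → Bool) : ℕ → ℕ → ℕ → Bool
  -- Running out of fuel counts as failure, so a successful run has exhausted all branches.
  | 0, _, _ => false
  | f + 1, k, t => strictly (fun k => strictly (fun t =>
      match S.nextForced t (4 * k) 0 with
      | 0 =>
        bif S.admissible t (4 * k) then
          strictly (fun x => bif Nat.beq x (4 * k) then chk k t else
            -- An eighth block would bring the number of corners to 32.
            (bif Nat.ble 7 k then true else
              search chk f (k + 1) (record (record t x (4 * k)) (4 * k) x)) &&
            allBelow (fun y => bif Nat.beq (entry t y) 0 then bif Nat.beq y x then true else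
              search chk f k (record (record t x y) y x) else true) (4 * k))
            (firstFree t (4 * k) 0)
        else true
      | c + 1 => strictly (fun x => strictly (fun y =>
          -- A forced partner that is already matched, or that is the place itself, contradicts a
          -- fixed-point-free involution and closes the branch.
          bif Nat.beq (entry t y) 0 then bif Nat.beq y x then true else
            search chk f k (record (record t x y) y x) else true) (c % 32)) (c / 32)) t) k

theorem strictly_eq {α : Type} (f : ℕ → α) (n : ℕ) : strictly f n = f n := by
  cases n <;> rfl

theorem entry_zero (x : ℕ) : entry 0 x = 0 := by simp [entry]

theorem testBit_entry (t x i : ℕ) :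
    (entry t x).testBit i = (t.testBit (5 * x + i) && decide (i < 5)) := by
  rw [entry, Nat.testBit_and, Nat.testBit_shiftRight, show 31 = 2 ^ 5 - 1 by norm_num,
    Nat.testBit_two_pow_sub_one]

/-- The five bits at `x` are empty and `y + 1` fits into five bits, so the disjunction writes this
digit and leaves the others alone. -/
theorem entry_record {t x y : ℕ} (hx : entry t x = 0) (hy : y < 31) (z : ℕ) :
    entry (record t x y) z = if z = x then y + 1 else entry t z := by
  apply Nat.eq_of_testBit_eq
  intro i
  rw [testBit_entry, record, Nat.testBit_or, Nat.testBit_shiftLeft]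
  have hbig : ∀ j, 5 ≤ j → (y + 1).testBit j = false := fun j hj =>
    Nat.testBit_lt_two_pow (lt_of_lt_of_le (show y + 1 < 2 ^ 5 by omega)
      (Nat.pow_le_pow_right (by norm_num) hj))
  split_ifs with h
  · subst h
    have := testBit_entry t z i
    rw [hx, Nat.zero_testBit] at this
    rcases Nat.lt_or_ge i 5 with hi | hi
    · simp_all
    · simp [hbig i hi, Nat.not_lt.2 hi]
  · rw [testBit_entry]
    rcases Nat.lt_or_ge i 5 with hi | hi
    · rcases Nat.lt_or_gt_of_ne h with h | h
      · have : ¬ (5 * x ≤ 5 * z + i) := by omega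
        simp [this]
      · simp [hbig (5 * z + i - 5 * x) (by omega)]
    · simp [Nat.not_lt.2 hi]

theorem allBelow_iff {p : ℕ → Bool} {n : ℕ} : allBelow p n = true ↔ ∀ x < n, p x = true := by
  induction n with
  | zero => simp [allBelow]
  | succ n ih =>
    rw [allBelow, cond_eq_ite]
    split_ifs with h
    · rw [ih]
      refine ⟨fun H x hx => ?_, fun H x hx => H x (by omega)⟩
      rcases Nat.lt_succ_iff_lt_or_eq.1 hx with hx | rfl
      · exact H x hx
      · exact h
    · simp only [false_iff, not_forall]
      exact ⟨n, by omega, h⟩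

theorem firstFree_spec (t m x : ℕ) :
    (firstFree t m x = x + m ∧ ∀ y, x ≤ y → y < x + m → entry t y ≠ 0) ∨
      (x ≤ firstFree t m x ∧ firstFree t m x < x + m ∧ entry t (firstFree t m x) = 0) := by
  induction m generalizing x with
  | zero => left; simp [firstFree]; omega
  | succ m ih =>
    rw [firstFree, strictly_eq, cond_eq_ite]
    simp only [Nat.beq_eq]
    split_ifs with h
    · exact Or.inr ⟨le_rfl, by omega, h⟩
    · rcases ih (x + 1) with ⟨h1, h2⟩ | ⟨h1, h2, h3⟩
      · refine Or.inl ⟨by omega, fun y hy hy' => ?_⟩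
        rcases Nat.eq_or_lt_of_le hy with rfl | hy
        · exact h
        · exact h2 y hy (by omega)
      · exact Or.inr ⟨by omega, by omega, h3⟩

end Scheme

open Scheme

namespace Gluing

variable {S : Scheme} {F : Type*} (G : Gluing S F)

/-- The corner with number `x`, when `β q` is the first corner of the block with number `q`. -/
def corner (β : ℕ → F) (x : ℕ) : F := G.act (x % 4) (β (x / 4))

/-- The table `t` describes the gluing of the blocks `β 0, …, β (k - 1)`. -/
structure Describes (β : ℕ → F) (k t : ℕ) : Prop where
  inj : ∀ x < 4 * k, ∀ y < 4 * k, G.corner β x = G.corner β y → x = y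
  entry : ∀ x y, Scheme.entry t x = y + 1 →
    x < 4 * k ∧ y < 4 * k ∧ G.tau (G.corner β x) = G.corner β y
  symm : ∀ x y, Scheme.entry t x = y + 1 → Scheme.entry t y = x + 1

variable {G} {β : ℕ → F} {k t : ℕ}

theorem act_corner (hS : S.Lawful) {x l : ℕ} (hl : l < 4) :
    G.act l (G.corner β x) = G.corner β (x / 4 * 4 + S.op (x % 4) l) := by
  have h := hS.op_lt (x % 4) (Nat.mod_lt _ (by norm_num)) l hl
  rw [corner, G.act_act _ (Nat.mod_lt _ (by norm_num)) _ hl, corner]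
  congr 2 <;> omega

/-- An undefined intermediate value stays 0 to the end of the word, so a nonzero result means that
each letter acted as in the gluing. -/
theorem trace_spec (hS : S.Lawful) (hD : G.Describes β k t) {w : List ℕ} (hw : ∀ l ∈ w, l ≤ 4)
    {x y : ℕ} (hx : x < 4 * k) (h : S.trace t w (x + 1) = y + 1) :
    y < 4 * k ∧ evalWord G.act G.tau w (G.corner β x) = G.corner β y := by
  induction w generalizing x with
  | nil =>
    simp only [trace, Nat.add_right_cancel_iff] at h
    subst h
    exact ⟨hx, rfl⟩
  | cons l w ih =>
    simp only [trace, cond_eq_ite, Nat.beq_eq] at h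
    have hw' : ∀ l ∈ w, l ≤ 4 := fun l hl => hw l (List.mem_cons_of_mem _ hl)
    have hl := hw l List.mem_cons_self
    simp only [evalWord, List.foldl_cons]
    split_ifs at h with hl4
    · rw [if_pos hl4]
      cases hz : Scheme.entry t x with
      | zero =>
        rw [hz] at h
        cases w <;> simp [trace] at h
      | succ z =>
        obtain ⟨-, hz', hz⟩ := hD.entry x z hz
        rw [hz]
        exact ih hw' hz' (by rw [← h, ‹Scheme.entry t x = z + 1›])
    · rw [if_neg hl4, act_corner hS (by omega)]
      have := hS.op_lt (x % 4) (Nat.mod_lt _ (by norm_num)) l (by omega)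
      exact ih hw' (by omega) h

theorem admissible_of_describes (hS : S.Lawful) (hD : G.Describes β k t) :
    S.admissible t (4 * k) = true := by
  rw [admissible, allBelow_iff]
  intro x hx
  rw [List.all_eq_true]
  intro p hp
  split
  · rfl
  · next a ha =>
    obtain ⟨h1, h2⟩ := hS.distinct_le p hp
    by_contra hne
    simp only [Bool.not_eq_true', Bool.not_eq_false, Nat.beq_eq] at hne
    exact G.distinct p hp _ ((trace_spec hS hD h1 hx ha).2.trans (trace_spec hS hD h2 hx hne).2.symm)

theorem forcedAt_spec (hS : S.Lawful) (hD : G.Describes β k t) {W : List (List ℕ)}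
    (hW : ∀ w ∈ W, w ∈ S.forced) {x y : ℕ} (hx : x < 4 * k) (h : S.forcedAt t x W = y + 1) :
    y < 4 * k ∧ G.tau (G.corner β x) = G.corner β y := by
  induction W with
  | nil => simp [forcedAt] at h
  | cons w W ih =>
    have hw := hW w List.mem_cons_self
    rw [forcedAt] at h
    split at h
    · exact ih (fun w hw => hW w (List.mem_cons_of_mem _ hw)) h
    · next z hz =>
      have := trace_spec hS hD (hS.forced_le w hw) hx (hz.trans h)
      rwa [G.forced w hw] at this

/-- With at most seven blocks both places are below 28, so quotient and remainder by 32 recover them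
from the code. -/
theorem nextForced_spec (hS : S.Lawful) (hD : G.Describes β k t) (hk : k ≤ 7) {m x c : ℕ}
    (hm : x + m ≤ 4 * k) (h : S.nextForced t m x = c + 1) :
    c / 32 < 4 * k ∧ c % 32 < 4 * k ∧ Scheme.entry t (c / 32) = 0 ∧
      G.tau (G.corner β (c / 32)) = G.corner β (c % 32) := by
  induction m generalizing x with
  | zero => simp [nextForced] at h
  | succ m ih =>
    rw [nextForced, strictly_eq, cond_eq_ite] at h
    simp only [Nat.beq_eq] at h
    split_ifs at h with h0
    · split at h
      · exact ih (by omega) h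
      · next y hy =>
        have := forcedAt_spec hS hD (fun _ h => h) (by omega) hy
        have h1 : c / 32 = x := by omega
        have h2 : c % 32 = y := by omega
        rw [h1, h2]
        exact ⟨by omega, this.1, h0, this.2⟩
    · exact ih (by omega) h

/-- The partner of an unmatched place is itself unmatched: a recorded partner of `y` would be `x` by
injectivity, and by symmetry of the table `x` would be matched too. -/
theorem Describes.record (hD : G.Describes β k t) (hk : k ≤ 7) {x y : ℕ} (hx : x < 4 * k)
    (hy : y < 4 * k) (hxy : G.tau (G.corner β x) = G.corner β y) (hx0 : Scheme.entry t x = 0) :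
    Scheme.entry t y = 0 ∧ y ≠ x ∧ G.Describes β k (record (record t x y) y x) := by
  have hyx : G.tau (G.corner β y) = G.corner β x := by rw [← hxy, G.tau_tau]
  have hne : y ≠ x := by
    rintro rfl
    exact G.tau_ne _ hxy
  have hy0 : Scheme.entry t y = 0 := by
    cases hz : Scheme.entry t y with
    | zero => rfl
    | succ z =>
      obtain ⟨-, hz', hyz⟩ := hD.entry y z hz
      have := hD.inj x hx z hz' (hyx.symm.trans hyz)
      subst this
      rw [hD.symm _ _ hz] at hx0
      omega
  have hrec : ∀ z, Scheme.entry (Scheme.record (Scheme.record t x y) y x) z =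
      if z = y then x + 1 else if z = x then y + 1 else Scheme.entry t z := fun z => by
    rw [entry_record (by rw [entry_record hx0 (by omega), if_neg hne, hy0]) (by omega),
      entry_record hx0 (by omega)]
  refine ⟨hy0, hne, hD.inj, fun z u hu => ?_, fun z u hu => ?_⟩ <;>
    rw [hrec] at hu
  · split_ifs at hu with h1 h2
    · subst h1
      obtain rfl : x = u := by omega
      exact ⟨hy, hx, hyx⟩
    · subst h2
      obtain rfl : y = u := by omega
      exact ⟨hx, hy, hxy⟩
    · exact hD.entry z u hu
  · rw [hrec]
    split_ifs at hu with h1 h2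
    · grind
    · grind
    · have := hD.symm z u hu
      grind

theorem Describes.le_seven [Finite F] (hF : Nat.card F < 32) (hD : G.Describes β k t) :
    k ≤ 7 := by
  have hinj : Function.Injective fun x : Fin (4 * k) => G.corner β x := fun x y hxy =>
    Fin.ext (hD.inj x x.2 y y.2 hxy)
  have := Nat.card_le_card_of_injective _ hinj
  rw [Nat.card_fin] at this
  omega

/-- If `tau` leads out of the numbered corners, the block reached is disjoint from all numbered
ones, since an element of the group could otherwise be undone inside a numbered block. Taking `tau`
of the corner as the first one of the new block gives it the number `4 * k`, so a single branch
covers this case. -/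
theorem Describes.new_block [Finite F] (hF : Nat.card F < 32) (hS : S.Lawful)
    (hD : G.Describes β k t) {x : ℕ} (hx : x < 4 * k) (hx0 : Scheme.entry t x = 0)
    (hnew : ∀ y < 4 * k, G.tau (G.corner β x) ≠ G.corner β y) :
    k < 7 ∧ G.Describes (Function.update β k (G.tau (G.corner β x))) (k + 1)
      (Scheme.record (Scheme.record t x (4 * k)) (4 * k) x) := by
  set β' := Function.update β k (G.tau (G.corner β x)) with hβ'
  have hold : ∀ y < 4 * k, G.corner β' y = G.corner β y := fun y hy => by
    rw [corner, hβ', Function.update_of_ne (by omega), corner]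
  have hblock : ∀ i < 4, G.corner β' (4 * k + i) = G.act i (G.tau (G.corner β x)) := fun i hi => by
    rw [corner, show (4 * k + i) % 4 = i by omega, show (4 * k + i) / 4 = k by omega, hβ',
      Function.update_self]
  have hdisj : ∀ i < 4, ∀ y < 4 * k, G.act i (G.tau (G.corner β x)) ≠ G.corner β y := by
    intro i hi y hy h
    obtain ⟨j, hj, hij⟩ := hS.exists_inv i hi
    have := congrArg (G.act j) h
    rw [G.act_act i hi j hj, hij, G.act_zero, act_corner hS hj] at this
    have hlt := hS.op_lt (y % 4) (Nat.mod_lt _ (by norm_num)) j hj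
    exact hnew _ (by omega) this
  have hD' : G.Describes β' (k + 1) t := by
    refine ⟨fun y hy z hz h => ?_, fun y z h => ?_, hD.symm⟩
    · rcases Nat.lt_or_ge y (4 * k) with hy' | hy' <;> rcases Nat.lt_or_ge z (4 * k) with hz' | hz'
      · rw [hold y hy', hold z hz'] at h
        exact hD.inj y hy' z hz' h
      · rw [hold y hy', show z = 4 * k + (z - 4 * k) by omega, hblock _ (by omega)] at h
        exact absurd h.symm (hdisj _ (by omega) _ hy')
      · rw [hold z hz', show y = 4 * k + (y - 4 * k) by omega, hblock _ (by omega)] at h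
        exact absurd h (hdisj _ (by omega) _ hz')
      · rw [show y = 4 * k + (y - 4 * k) by omega, show z = 4 * k + (z - 4 * k) by omega,
          hblock _ (by omega), hblock _ (by omega)] at h
        have := G.act_free _ (by omega) _ (by omega) _ h
        omega
    · obtain ⟨h1, h2, h3⟩ := hD.entry y z h
      rw [hold y h1, hold z h2]
      exact ⟨by omega, by omega, h3⟩
  have hk := hD'.le_seven hF
  refine ⟨by omega, (hD'.record (by omega) (by omega) (by omega) ?_ hx0).2.2⟩
  rw [hold x hx]
  have := hblock 0 (by norm_num)
  rw [G.act_zero, Nat.add_zero] at this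
  exact this.symm

/-- The search finds every gluing with less than `32` corners. -/
theorem exists_of_search [Finite F] (hF : Nat.card F < 32) (hS : S.Lawful) {chk : ℕ → ℕ → Bool}
    {f : ℕ} (h : S.search chk f k t = true) (hD : G.Describes β k t) :
    ∃ β' k' t', G.Describes β' k' t' ∧ (∀ x < 4 * k', Scheme.entry t' x ≠ 0) ∧ k ≤ k' ∧
      chk k' t' = true := by
  induction f generalizing β k t with
  | zero => simp [search] at h
  | succ f ih =>
    have hk : k ≤ 7 := hD.le_seven hF
    rw [search, strictly_eq, strictly_eq] at h
    split at h
    · rw [admissible_of_describes hS hD, cond_true, strictly_eq, cond_eq_ite] at h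
      rcases firstFree_spec t (4 * k) 0 with ⟨h1, h2⟩ | ⟨-, h1, h2⟩
      · rw [if_pos (by rw [Nat.beq_eq]; omega)] at h
        exact ⟨β, k, t, hD, fun x hx => h2 x (by omega) (by omega), le_rfl, h⟩
      · generalize firstFree t (4 * k) 0 = x at h h1 h2
        rw [if_neg (by rw [Nat.beq_eq]; omega), Bool.and_eq_true, allBelow_iff] at h
        -- The actual gluing selects the branch: a new block, or the numbered partner `y`.
        by_cases hnew : ∀ y < 4 * k, G.tau (G.corner β x) ≠ G.corner β y
        · obtain ⟨hk7, hD'⟩ := hD.new_block hF hS (by omega) h2 hnew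
          have h3 := h.1
          rw [cond_eq_ite, if_neg (by rw [Nat.ble_eq]; omega)] at h3
          obtain ⟨β', k', t', H1, H2, H3, H4⟩ := ih h3 hD'
          exact ⟨β', k', t', H1, H2, by omega, H4⟩
        · push Not at hnew
          obtain ⟨y, hy, hxy⟩ := hnew
          obtain ⟨hy0, hne, hD'⟩ := hD.record hk (by omega) hy hxy h2
          have h3 := h.2 y hy
          rw [cond_eq_ite, if_pos (by rw [Nat.beq_eq]; exact hy0), cond_eq_ite,
            if_neg (by rw [Nat.beq_eq]; exact hne)] at h3
          exact ih h3 hD'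
    · next c hc =>
      obtain ⟨h1, h2, h3, h4⟩ := nextForced_spec hS hD hk (by omega) hc
      obtain ⟨hy0, hne, hD'⟩ := hD.record hk h1 h2 h4 h3
      rw [strictly_eq, strictly_eq, cond_eq_ite, if_pos (by rw [Nat.beq_eq]; exact hy0),
        cond_eq_ite, if_neg (by rw [Nat.beq_eq]; exact hne)] at h
      exact ih h hD'

end Gluing

/-! ### Cycles coded by numbers -/

/-- The number of the edge `ab`. -/
def edgeCode (a b : ℕ) : ℕ := 32 * min a b + max a b

/-- The set of edges of the closed polygon `l` as a number, each edge being a binary digit. -/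
def cycleMask (l : List ℕ) : ℕ :=
  ((l.zip (l.rotate 1)).map fun p => 1 <<< edgeCode p.1 p.2).foldr (· ||| ·) 0

theorem testBit_cycleMask (l : List ℕ) (i : ℕ) :
    (cycleMask l).testBit i = true ↔ ∃ p ∈ l.zip (l.rotate 1), edgeCode p.1 p.2 = i := by
  unfold cycleMask
  induction l.zip (l.rotate 1) with
  | nil => simp
  | cons p L ih =>
    rw [List.map_cons, List.foldr_cons, Nat.testBit_or, Bool.or_eq_true, ih, Nat.shiftLeft_eq,
      one_mul, Nat.testBit_two_pow]
    simp

/-- For vertices below 32 the code `32 * min + max` determines the unordered pair. Comparing two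
faces thus becomes comparing two numbers. -/
theorem mem_cycleEdges_iff_testBit {n : ℕ} (hn : n ≤ 32) (l : List (Fin n)) (a b : Fin n) :
    s(a, b) ∈ cycleEdges l ↔ (cycleMask (l.map Fin.val)).testBit (edgeCode a b) = true := by
  rw [testBit_cycleMask, ← List.map_rotate, List.zip_map, cycleEdges, List.mem_toFinset]
  rw [show List.zipWith (fun a b => s(a, b)) l (l.rotate 1) =
    (l.zip (l.rotate 1)).map fun p => s(p.1, p.2) by rw [List.zip, List.map_zipWith]]
  simp only [List.mem_map, Prod.exists, Prod.map_apply, Sym2.eq_iff]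
  constructor
  · rintro ⟨c, d, h, h'⟩
    refine ⟨c, d, ⟨c, d, h, rfl⟩, ?_⟩
    rcases h' with ⟨rfl, rfl⟩ | ⟨rfl, rfl⟩
    · rfl
    · simp only [edgeCode, min_comm, max_comm]
  · rintro ⟨_, _, ⟨c, d, h, h'⟩, h''⟩
    obtain ⟨rfl, rfl⟩ := Prod.mk.inj h'
    refine ⟨c, d, h, ?_⟩
    simp only [edgeCode] at h''
    simp only [Fin.ext_iff]
    omega

theorem cycleEdges_eq_of_cycleMask_eq {n : ℕ} (hn : n ≤ 32) {l l' : List (Fin n)}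
    (h : cycleMask (l.map Fin.val) = cycleMask (l'.map Fin.val)) :
    cycleEdges l = cycleEdges l' := by
  ext e
  induction e with
  | h a b => rw [mem_cycleEdges_iff_testBit hn, mem_cycleEdges_iff_testBit hn, h]

/-! ### Maps built from a gluing -/

/-- The corners of the map `M` form a gluing according to the scheme `S`. -/
structure Realization {V : Type*} [DecidableEq V] (S : Scheme) (M : Finset (Finset (Sym2 V)))
    (F : Type*) extends Gluing S F where
  vert : F → V
  vert_eq_iff : ∀ x y, vert x = vert y ↔ y = x ∨ y = evalWord act tau S.mate x
  face_iff : ∀ C, C ∈ M ↔ ∃ x, ∃ p ∈ S.polygons,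
    C = cycleEdges (p.map fun w => vert (evalWord act tau w x))

namespace Realization

variable {V F : Type*} [DecidableEq V] {S : Scheme} {M : Finset (Finset (Sym2 V))}
  (R : Realization S M F)

theorem vert_surjective (hcov : ∀ v : V, ∃ C ∈ M, v ∈ verts C) : Function.Surjective R.vert := by
  intro v
  obtain ⟨C, hC, hv⟩ := hcov v
  obtain ⟨x, p, hp, rfl⟩ := (R.face_iff C).1 hC
  rw [verts_cycleEdges, List.mem_toFinset, List.mem_map] at hv
  obtain ⟨w, -, hw⟩ := hv
  exact ⟨_, hw⟩

include R in
/-- At each vertex there are at most two corners. -/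
theorem exists_injective (hcov : ∀ v : V, ∃ C ∈ M, v ∈ verts C) :
    ∃ j : F → V × Bool, Function.Injective j := by
  classical
  choose c hc using R.vert_surjective hcov
  refine ⟨fun x => (R.vert x, decide (x = c (R.vert x))), fun x y h => ?_⟩
  obtain ⟨h1, h2⟩ := Prod.mk.inj h
  rw [decide_eq_decide, ← h1] at h2
  have hx := (R.vert_eq_iff _ x).1 (hc (R.vert x))
  have hy := (R.vert_eq_iff _ y).1 ((hc (R.vert x)).trans h1)
  grind

section Closed

variable {A : Set F} (htau : ∀ x ∈ A, R.tau x ∈ A) (hact : ∀ x ∈ A, ∀ i < 4, R.act i x ∈ A)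
include htau hact

theorem evalWord_mem {w : List ℕ} (hw : ∀ l ∈ w, l ≤ 4) {x : F} (hx : x ∈ A) :
    evalWord R.act R.tau w x ∈ A := by
  induction w generalizing x with
  | nil => exact hx
  | cons l w ih =>
    have hl := hw l List.mem_cons_self
    refine ih (fun l hl => hw l (List.mem_cons_of_mem _ hl)) ?_
    simp only
    split_ifs
    · exact htau x hx
    · exact hact x hx l (by omega)

/-- Every letter is undone by a letter: `tau` by itself, a group element by its inverse. A set
closed under the letters is therefore closed under their inverses. -/
theorem mem_of_evalWord_mem (hS : S.Lawful) {w : List ℕ} (hw : ∀ l ∈ w, l ≤ 4) {x : F}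
    (hx : evalWord R.act R.tau w x ∈ A) : x ∈ A := by
  induction w generalizing x with
  | nil => exact hx
  | cons l w ih =>
    have hl := hw l List.mem_cons_self
    have h := ih (fun l hl => hw l (List.mem_cons_of_mem _ hl)) hx
    simp only at h
    split_ifs at h
    · rw [← R.tau_tau x]
      exact htau _ h
    · obtain ⟨j, hj, hlj⟩ := hS.exists_inv l (by omega)
      have := hact _ h j hj
      rwa [R.act_act l (by omega) j hj, hlj, R.act_zero] at this

end Closed

/-- The vertices carried by `A` are closed under passing to another vertex of a common face: from a
vertex of the face one returns to the corner that generates the face, and from there a word leads to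
any other vertex. So every vertex is carried by `A`, and so is its other corner, which is reached by
the word `S.mate`. -/
theorem mem_of_closed (hS : S.Lawful)
    (hconn : ∀ B : Set V, B.Nonempty →
      (∀ C ∈ M, ∀ v ∈ verts C, ∀ w ∈ verts C, v ∈ B → w ∈ B) → ∀ w, w ∈ B)
    {A : Set F} (hA : A.Nonempty) (htau : ∀ x ∈ A, R.tau x ∈ A)
    (hact : ∀ x ∈ A, ∀ i < 4, R.act i x ∈ A) (x : F) : x ∈ A := by
  have hvert : ∀ x y, R.vert x = R.vert y → x ∈ A → y ∈ A := by
    intro x y h hx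
    rcases (R.vert_eq_iff x y).1 h with rfl | rfl
    · exact hx
    · exact R.evalWord_mem htau hact hS.mate_le hx
  obtain ⟨a, ha, hax⟩ := hconn (R.vert '' A) (hA.image _) (by
    rintro C hC v hv w hw ⟨a, ha, rfl⟩
    obtain ⟨x, p, hp, rfl⟩ := (R.face_iff C).1 hC
    rw [verts_cycleEdges, List.mem_toFinset, List.mem_map] at hv hw
    obtain ⟨w₁, hw₁, h₁⟩ := hv
    obtain ⟨w₂, hw₂, rfl⟩ := hw
    have := R.mem_of_evalWord_mem htau hact hS (hS.polygons_le p hp w₁ hw₁)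
      (hvert _ _ h₁.symm ha)
    exact ⟨_, R.evalWord_mem htau hact (hS.polygons_le p hp w₂ hw₂) this, rfl⟩) (R.vert x)
  exact hvert a x hax ha

end Realization

/-! ### Comparison of a complete table with a given map -/

namespace Scheme

variable (S : Scheme)

/-- The number to which the word `w` leads from `x`. -/
def target (t : ℕ) (w : List ℕ) (x : ℕ) : ℕ := S.trace t w (x + 1) - 1

/-- Whether the vertex `g x` at the corner `x` defines an isomorphism of the map with table `t`,
for `k` blocks, to the map with the given faces. -/
def isLabelling {n : ℕ} [NeZero n] (faces : List (List (Fin n))) (k t : ℕ) (g : List (Fin n)) :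
    Bool :=
  let lab (x : ℕ) : ℕ := g.getD x 0
  let masks : List ℕ := (List.range (4 * k)).flatMap fun x =>
    S.polygons.map fun p => cycleMask (p.map fun w => lab (S.target t w x))
  Nat.beq g.length (4 * k) &&
  allBelow (fun x => Nat.beq (lab (S.target t S.mate x)) (lab x)) (4 * k) &&
  allBelow (fun x => allBelow (fun y => !Nat.beq (lab x) (lab y) || Nat.beq y x ||
    Nat.beq y (S.target t S.mate x)) (4 * k)) (4 * k) &&
  ((List.finRange n).all fun i => !allBelow (fun x => !Nat.beq (lab x) i) (4 * k)) &&
  (masks.all fun m => faces.any fun l => Nat.beq m (cycleMask (l.map Fin.val))) &&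
  faces.all fun l => masks.any fun m => Nat.beq m (cycleMask (l.map Fin.val))

variable {S}

theorem trace_ne_zero (hS : S.Lawful) {k t : ℕ} {w : List ℕ} (hw : ∀ l ∈ w, l ≤ 4)
    (ht : ∀ x < 4 * k, entry t x ≠ 0 ∧ entry t x ≤ 4 * k) {x : ℕ} (hx : x < 4 * k) :
    S.trace t w (x + 1) ≠ 0 := by
  induction w generalizing x with
  | nil => simp [trace]
  | cons l w ih =>
    have hl := hw l List.mem_cons_self
    have hw' : ∀ l ∈ w, l ≤ 4 := fun l hl => hw l (List.mem_cons_of_mem _ hl)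
    simp only [trace, cond_eq_ite]
    split_ifs with h
    · obtain ⟨h1, h2⟩ := ht x hx
      obtain ⟨y, hy⟩ := Nat.exists_eq_succ_of_ne_zero h1
      rw [hy]
      exact ih hw' (by omega)
    · rw [Nat.beq_eq] at h
      have := hS.op_lt (x % 4) (Nat.mod_lt _ (by norm_num)) l (by omega)
      exact ih hw' (by omega)

end Scheme

open Gluing in
-- The corners of a complete table are closed under the group and `tau`, hence are all corners. The
-- checks in `isLabelling` say that two of them have equal labels exactly when they lie at the same
-- vertex, that all labels occur, and that the faces correspond in both directions.
theorem Realization.iso_of_isLabelling {V F : Type*} [DecidableEq V] {S : Scheme}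
    {M : Finset (Finset (Sym2 V))} (R : Realization S M F) (hS : S.Lawful)
    (hcov : ∀ v : V, ∃ C ∈ M, v ∈ verts C)
    (hconn : ∀ B : Set V, B.Nonempty →
      (∀ C ∈ M, ∀ v ∈ verts C, ∀ w ∈ verts C, v ∈ B → w ∈ B) → ∀ w, w ∈ B)
    {β : ℕ → F} {k t : ℕ} (hD : R.Describes β k t) (hk : 0 < k)
    (ht : ∀ x < 4 * k, entry t x ≠ 0) {n : ℕ} [NeZero n] (hn : n ≤ 32)
    {faces : List (List (Fin n))} {g : List (Fin n)} (hg : S.isLabelling faces k t g = true) :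
    Iso M (ofLists faces) := by
  have htarget : ∀ w : List ℕ, (∀ l ∈ w, l ≤ 4) → ∀ x < 4 * k, S.target t w x < 4 * k ∧
      evalWord R.act R.tau w (R.corner β x) = R.corner β (S.target t w x) := by
    intro w hw x hx
    have : S.trace t w (x + 1) ≠ 0 := trace_ne_zero hS hw (fun y hy => by
      obtain ⟨z, hz⟩ := Nat.exists_eq_succ_of_ne_zero (ht y hy)
      have := hD.entry y z hz
      exact ⟨ht y hy, by omega⟩) hx
    exact trace_spec hS hD hw hx (by rw [target]; omega)
  have hsurj : ∀ y, ∃ x < 4 * k, R.corner β x = y := by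
    refine R.mem_of_closed hS hconn (A := {y | ∃ x < 4 * k, R.corner β x = y})
      ⟨_, 0, by omega, rfl⟩ ?_ ?_
    · rintro _ ⟨x, hx, rfl⟩
      have := htarget [4] (by simp) x hx
      exact ⟨_, this.1, this.2.symm⟩
    · rintro _ ⟨x, hx, rfl⟩ i hi
      rw [act_corner hS hi]
      have := hS.op_lt (x % 4) (Nat.mod_lt _ (by norm_num)) i hi
      exact ⟨_, by omega, rfl⟩
  simp only [isLabelling, Bool.and_eq_true, allBelow_iff, Bool.or_eq_true, Nat.beq_eq,
    Bool.not_eq_true', List.all_eq_true, List.any_eq_true, List.mem_flatMap, List.mem_map,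
    List.mem_range, List.mem_finRange, forall_const] at hg
  obtain ⟨⟨⟨⟨⟨-, h1⟩, h2⟩, h3⟩, h4⟩, h5⟩ := hg
  have hcor : ∀ v, ∃ x < 4 * k, R.vert (R.corner β x) = v := by
    intro v
    obtain ⟨y, rfl⟩ := R.vert_surjective hcov v
    obtain ⟨x, hx, rfl⟩ := hsurj y
    exact ⟨x, hx, rfl⟩
  choose c hc hcv using hcor
  have hmate := fun x hx => htarget S.mate hS.mate_le x hx
  -- The label of a vertex does not depend on which of its corners `c` has picked.
  have hwd : ∀ x < 4 * k, g.getD (c (R.vert (R.corner β x))) 0 = g.getD x 0 := by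
    intro x hx
    rcases (R.vert_eq_iff _ _).1 (hcv (R.vert (R.corner β x))).symm with h | h
    · rw [hD.inj _ (hc _) _ hx h]
    · rw [(hmate x hx).2] at h
      rw [hD.inj _ (hc _) _ (hmate x hx).1 h]
      exact Fin.ext (h1 x hx)
  have hbij : Function.Bijective fun v => g.getD (c v) 0 := by
    constructor
    · intro v w h
      rw [← hcv v, ← hcv w, R.vert_eq_iff, (hmate _ (hc v)).2]
      rcases h2 (c v) (hc v) (c w) (hc w) with (h' | h') | h'
      · have : (g.getD (c v) 0).val = (g.getD (c w) 0).val := congrArg _ h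
        rw [← Nat.beq_eq, h'] at this
        exact absurd this (by simp)
      · exact Or.inl (by rw [h'])
      · exact Or.inr (by rw [h'])
    · intro i
      by_contra hne
      have : allBelow (fun x => !Nat.beq (g.getD x 0) i) (4 * k) = true := by
        rw [allBelow_iff]
        intro x hx
        rw [Bool.not_eq_true', ← Bool.not_eq_true, Nat.beq_eq]
        intro h
        exact hne ⟨R.vert (R.corner β x), (hwd x hx).trans (Fin.ext h)⟩
      rw [h3 i] at this
      exact absurd this (by simp)
  have himage : ∀ x < 4 * k, ∀ p ∈ S.polygons,
      (cycleEdges (p.map fun w => R.vert (evalWord R.act R.tau w (R.corner β x)))).image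
        (Sym2.map (Equiv.ofBijective _ hbij)) =
      cycleEdges (p.map fun w => g.getD (S.target t w x) 0) := by
    intro x hx p hp
    rw [← cycleEdges_map, List.map_map]
    congr 1
    refine List.map_congr_left fun w hw => ?_
    obtain ⟨h, h'⟩ := htarget w (hS.polygons_le p hp w hw) x hx
    simp only [Function.comp_apply, Equiv.ofBijective_apply, h', hwd _ h]
  refine ⟨Equiv.ofBijective _ hbij, fun C => ?_⟩
  simp only [ofLists, List.mem_toFinset, List.mem_map]
  constructor
  · rintro ⟨l, hl, hlC⟩
    obtain ⟨m, ⟨x, hx, p, hp, rfl⟩, hm⟩ := h5 l hl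
    have : cycleEdges (p.map fun w => g.getD (S.target t w x) 0) = cycleEdges l := by
      apply cycleEdges_eq_of_cycleMask_eq hn
      rw [List.map_map]
      exact hm
    rw [← himage x hx p hp, hlC] at this
    rw [R.face_iff]
    exact ⟨_, p, hp, (Finset.image_injective (Sym2.map.injective (Equiv.injective _)) this).symm⟩
  · intro hC
    obtain ⟨y, p, hp, rfl⟩ := (R.face_iff C).1 hC
    obtain ⟨x, hx, rfl⟩ := hsurj y
    obtain ⟨l, hl, hm⟩ := h4 _ ⟨x, hx, p, hp, rfl⟩
    refine ⟨l, hl, ?_⟩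
    rw [himage x hx p hp]
    apply cycleEdges_eq_of_cycleMask_eq hn
    rw [List.map_map]
    exact hm.symm

open Gluing in
theorem Gluing.describes_one {S : Scheme} {F : Type*} (G : Gluing S F) (x : F) :
    G.Describes (fun _ => x) 1 0 where
  inj y hy z hz h := by
    have := G.act_free _ (Nat.mod_lt _ (by norm_num)) _ (Nat.mod_lt _ (by norm_num)) _ h
    omega
  entry y z h := by simp [entry_zero] at h
  symm y z h := by simp [entry_zero] at h

open Gluing in
/-- The search finds every map with at most `15` vertices. -/
theorem Realization.exists_of_search {V F : Type*} [Fintype V] [DecidableEq V] {S : Scheme}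
    {M : Finset (Finset (Sym2 V))} (R : Realization S M F) (hS : S.Lawful)
    (hcov : ∀ v : V, ∃ C ∈ M, v ∈ verts C) (hconn : IsConnected (carrier M))
    (hV : Fintype.card V ≤ 15) {chk : ℕ → ℕ → Bool} {f : ℕ} (h : S.search chk f 1 0 = true) :
    ∃ k t, chk k t = true ∧ ∀ (n : ℕ) [NeZero n] (faces : List (List (Fin n))) (g : List (Fin n)),
      n ≤ 32 → S.isLabelling faces k t g = true → Iso M (ofLists faces) := by
  obtain ⟨j, hj⟩ := R.exists_injective hcov
  have : Finite F := Finite.of_injective j hj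
  -- Two corners at each of at most 15 vertices.
  have hF : Nat.card F < 32 := by
    have := Nat.card_le_card_of_injective j hj
    rw [Nat.card_prod, Nat.card_eq_fintype_card (α := V), Nat.card_eq_fintype_card (α := Bool),
      Fintype.card_bool] at this
    omega
  obtain ⟨p, hp⟩ := hconn.nonempty
  obtain ⟨C, hC, -⟩ := mem_carrier.1 hp
  obtain ⟨x, -⟩ := (R.face_iff C).1 hC
  -- The search starts with the block of an arbitrary corner and the empty table.
  obtain ⟨β, k, t, hD, ht, hk, hchk⟩ := Gluing.exists_of_search hF hS h (R.describes_one x)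
  exact ⟨k, t, hchk, fun n _ faces g hn hg => R.iso_of_isLabelling hS hcov
    (fun B hB hcl => mem_of_isConnected_carrier hcov hconn hB hcl) hD hk ht hn hg⟩

/-! ### Verification of a given map -/

/-- Whether the faces are cycles, the lists in `W` are wheels around the vertices `0, 1, …`, and
every vertex but `0` has a common face with a smaller one. -/
def isWheelSystem {n : ℕ} [NeZero n] (w : List (List (Fin 8))) (faces : List (List (Fin n)))
    (W : List (List (Fin n))) : Bool :=
  (faces.all fun l => decide l.Nodup && Nat.ble 3 l.length) &&
  ((List.finRange n).all fun v =>
    let f (i : Fin 8) : Fin n := (W.getD v []).getD i 0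
    (decide (Function.Injective f) && decide (f 0 = v)) &&
    (w.all fun l => faces.any fun l' =>
      Nat.beq (cycleMask ((l.map f).map Fin.val)) (cycleMask (l'.map Fin.val))) &&
    faces.all fun l' => !decide (v ∈ l') || w.any fun l =>
      Nat.beq (cycleMask ((l.map f).map Fin.val)) (cycleMask (l'.map Fin.val))) &&
  (List.finRange n).all fun v => decide (v = 0) ||
    faces.any fun l => decide (v ∈ l) && l.any fun u => decide (u < v)

theorem hasWheel_of_isWheelSystem {n : ℕ} [NeZero n] (hn : n ≤ 32) {w : List (List (Fin 8))}
    (hw : w ≠ []) (hw0 : ∀ l ∈ w, (0 : Fin 8) ∈ l) {faces W : List (List (Fin n))}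
    (h : isWheelSystem w faces W = true) :
    (∀ C ∈ ofLists faces, IsCycle C) ∧ (∀ v, HasWheel (ofLists faces) w v) ∧
      IsConnected (carrier (ofLists faces)) := by
  simp only [isWheelSystem, Bool.and_eq_true, List.all_eq_true, decide_eq_true_eq, Nat.ble_eq,
    List.mem_finRange, forall_const, Bool.or_eq_true, List.any_eq_true, Nat.beq_eq,
    Bool.not_eq_true', decide_eq_false_iff_not] at h
  obtain ⟨⟨h1, h2⟩, h3⟩ := h
  have hmem : ∀ C, C ∈ ofLists faces ↔ ∃ l ∈ faces, cycleEdges l = C := fun C => by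
    simp [ofLists]
  have hwheel : ∀ v, HasWheel (ofLists faces) w v := by
    intro v
    obtain ⟨⟨⟨hf, hv⟩, h4⟩, h5⟩ := h2 v
    refine ⟨_, hf, hv, fun C => ⟨?_, ?_⟩⟩
    · rintro ⟨hC, hvC⟩
      obtain ⟨l', hl', rfl⟩ := (hmem C).1 hC
      rw [verts_cycleEdges, List.mem_toFinset] at hvC
      rcases h5 l' hl' with h | ⟨l, hl, h⟩
      · exact absurd hvC h
      · exact ⟨l, hl, (cycleEdges_eq_of_cycleMask_eq hn h).symm⟩
    · rintro ⟨l, hl, rfl⟩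
      obtain ⟨l', hl', h⟩ := h4 l hl
      refine ⟨(hmem _).2 ⟨l', hl', (cycleEdges_eq_of_cycleMask_eq hn h).symm⟩, ?_⟩
      rw [verts_cycleEdges, List.mem_toFinset, List.mem_map]
      exact ⟨0, hw0 l hl, hv⟩
  refine ⟨fun C hC => ?_, hwheel, isConnected_carrier 0 ?_ fun A hA hcl v => ?_⟩
  · obtain ⟨l, hl, rfl⟩ := (hmem C).1 hC
    exact ⟨l, (h1 l hl).1, (h1 l hl).2, rfl⟩
  · obtain ⟨f, -, -, hf⟩ := hwheel 0
    obtain ⟨l, hl⟩ := List.exists_mem_of_ne_nil w hw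
    exact ⟨_, (hf _).2 ⟨l, hl, rfl⟩⟩
  -- Each vertex but 0 shares a face with a smaller one, so descent reaches 0.
  · induction hv : v.val using Nat.strong_induction_on generalizing v with
    | _ m ih =>
      rcases h3 v with rfl | ⟨l, hl, hvl, u, hul, huv⟩
      · exact hA
      · exact hcl _ ((hmem _).2 ⟨l, hl, rfl⟩) u (by simpa [verts_cycleEdges]) v
          (by simpa [verts_cycleEdges]) (ih u (by omega) u rfl)

/-! ### Triangles and quadrangles at a vertex. -/

section Local

variable {V : Type*} [DecidableEq V]

/-- The triangle `abc` is a face. -/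
def IsTri (M : Finset (Finset (Sym2 V))) (a b c : V) : Prop :=
  [a, b, c].Nodup ∧ cycleEdges [a, b, c] ∈ M

/-- The quadrangle `abcd` is a face. -/
def IsQuad (M : Finset (Finset (Sym2 V))) (a b c d : V) : Prop :=
  [a, b, c, d].Nodup ∧ cycleEdges [a, b, c, d] ∈ M

variable {M : Finset (Finset (Sym2 V))} {a b c d v : V}

theorem IsTri.rotate (h : IsTri M a b c) : IsTri M b c a :=
  ⟨by have := h.1; grind, cycleEdges_three_rotate a b c ▸ h.2⟩

theorem IsTri.swap (h : IsTri M a b c) : IsTri M a c b :=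
  ⟨by have := h.1; grind, cycleEdges_three_swap a b c ▸ h.2⟩

theorem IsQuad.rotate (h : IsQuad M a b c d) : IsQuad M b c d a :=
  ⟨by have := h.1; grind, cycleEdges_four_rotate a b c d ▸ h.2⟩

theorem IsQuad.swap (h : IsQuad M a b c d) : IsQuad M a d c b :=
  ⟨by have := h.1; grind, cycleEdges_four_swap a b c d ▸ h.2⟩

theorem IsTri.ne (h : IsTri M a b c) : a ≠ b ∧ a ≠ c ∧ b ≠ c := by
  have := h.1; grind

theorem IsQuad.ne (h : IsQuad M a b c d) : a ≠ b ∧ a ≠ c ∧ a ≠ d ∧ b ≠ c ∧ b ≠ d ∧ c ≠ d := by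
  have := h.1; grind

theorem card_three (h : [a, b, c].Nodup) : (cycleEdges [a, b, c]).card = 3 :=
  card_cycleEdges h (by simp)

theorem card_four (h : [a, b, c, d].Nodup) : (cycleEdges [a, b, c, d]).card = 4 :=
  card_cycleEdges h (by simp)

/-- A wheel of type `(3³, 4²)`, by its triangles and quadrangles. -/
theorem HasWheel.exists_33344 (h : HasWheel M wheel33344 v) : ∃ p q r s t y z,
    [v, p, q, r, s, t, y, z].Nodup ∧
    (∀ a b, IsTri M v a b ↔ (a = t ∧ b = p) ∨ (a = p ∧ b = t) ∨ (a = p ∧ b = q) ∨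
      (a = q ∧ b = p) ∨ (a = q ∧ b = r) ∨ (a = r ∧ b = q)) ∧
    ∀ a b c, IsQuad M v a b c ↔ (a = r ∧ b = y ∧ c = s) ∨ (a = s ∧ b = y ∧ c = r) ∨
      (a = s ∧ b = z ∧ c = t) ∨ (a = t ∧ b = z ∧ c = s) := by
  obtain ⟨f, hf, rfl, hC⟩ := h
  have hnd : [f 0, f 1, f 2, f 3, f 4, f 5, f 6, f 7].Nodup :=
    List.Nodup.map (l := [0, 1, 2, 3, 4, 5, 6, 7]) hf (by decide)
  simp only [wheel33344, List.mem_cons, List.not_mem_nil, or_false, exists_eq_or_imp,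
    exists_eq_left, List.map_cons, List.map_nil] at hC
  refine ⟨f 1, f 2, f 3, f 4, f 5, f 6, f 7, hnd, fun a b => ⟨fun ⟨h, h'⟩ => ?_, ?_⟩,
    fun a b c => ⟨fun ⟨h, h'⟩ => ?_, ?_⟩⟩
  · have h3 := card_three h
    rcases (hC _).1 ⟨h', by simp [verts_cycleEdges]⟩ with e | e | e | e | e
    · have := cycleEdges_three_inj h e; grind
    · have := cycleEdges_three_inj h e; grind
    · have := cycleEdges_three_inj h e; grind
    · rw [e, card_four (by grind)] at h3; omega
    · rw [e, card_four (by grind)] at h3; omega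
  · have h1 : IsTri M (f 0) (f 5) (f 1) := ⟨by grind, ((hC _).2 (by simp)).1⟩
    have h2 : IsTri M (f 0) (f 1) (f 2) := ⟨by grind, ((hC _).2 (by simp)).1⟩
    have h3 : IsTri M (f 0) (f 2) (f 3) := ⟨by grind, ((hC _).2 (by simp)).1⟩
    have h4 := h1.swap
    have h5 := h2.swap
    have h6 := h3.swap
    clear hC
    rintro (⟨rfl, rfl⟩ | ⟨rfl, rfl⟩ | ⟨rfl, rfl⟩ | ⟨rfl, rfl⟩ | ⟨rfl, rfl⟩ | ⟨rfl, rfl⟩) <;>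
      assumption
  · have h4 := card_four h
    rcases (hC _).1 ⟨h', by simp [verts_cycleEdges]⟩ with e | e | e | e | e
    · rw [e, card_three (by grind)] at h4; omega
    · rw [e, card_three (by grind)] at h4; omega
    · rw [e, card_three (by grind)] at h4; omega
    · have := cycleEdges_four_inj h (by grind) e; grind
    · have := cycleEdges_four_inj h (by grind) e; grind
  · have h1 : IsQuad M (f 0) (f 3) (f 6) (f 4) := ⟨by grind, ((hC _).2 (by simp)).1⟩
    have h2 : IsQuad M (f 0) (f 4) (f 7) (f 5) := ⟨by grind, ((hC _).2 (by simp)).1⟩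
    have h3 := h1.swap
    have h4 := h2.swap
    clear hC
    rintro (⟨rfl, rfl, rfl⟩ | ⟨rfl, rfl, rfl⟩ | ⟨rfl, rfl, rfl⟩ | ⟨rfl, rfl, rfl⟩) <;> assumption

/-- A wheel of type `(3², 4, 3, 4)`, by its triangles and quadrangles. -/
theorem HasWheel.exists_33434 (h : HasWheel M wheel33434 v) : ∃ p q r s t y z,
    [v, p, q, r, s, t, y, z].Nodup ∧
    (∀ a b, IsTri M v a b ↔ (a = t ∧ b = p) ∨ (a = p ∧ b = t) ∨ (a = p ∧ b = q) ∨
      (a = q ∧ b = p) ∨ (a = r ∧ b = s) ∨ (a = s ∧ b = r)) ∧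
    ∀ a b c, IsQuad M v a b c ↔ (a = q ∧ b = y ∧ c = r) ∨ (a = r ∧ b = y ∧ c = q) ∨
      (a = s ∧ b = z ∧ c = t) ∨ (a = t ∧ b = z ∧ c = s) := by
  obtain ⟨f, hf, rfl, hC⟩ := h
  have hnd : [f 0, f 1, f 2, f 3, f 4, f 5, f 6, f 7].Nodup :=
    List.Nodup.map (l := [0, 1, 2, 3, 4, 5, 6, 7]) hf (by decide)
  simp only [wheel33434, List.mem_cons, List.not_mem_nil, or_false, exists_eq_or_imp,
    exists_eq_left, List.map_cons, List.map_nil] at hC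
  refine ⟨f 1, f 2, f 3, f 4, f 5, f 6, f 7, hnd, fun a b => ⟨fun ⟨h, h'⟩ => ?_, ?_⟩,
    fun a b c => ⟨fun ⟨h, h'⟩ => ?_, ?_⟩⟩
  · have h3 := card_three h
    rcases (hC _).1 ⟨h', by simp [verts_cycleEdges]⟩ with e | e | e | e | e
    · have := cycleEdges_three_inj h e; grind
    · have := cycleEdges_three_inj h e; grind
    · rw [e, card_four (by grind)] at h3; omega
    · have := cycleEdges_three_inj h e; grind
    · rw [e, card_four (by grind)] at h3; omega
  · have h1 : IsTri M (f 0) (f 5) (f 1) := ⟨by grind, ((hC _).2 (by simp)).1⟩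
    have h2 : IsTri M (f 0) (f 1) (f 2) := ⟨by grind, ((hC _).2 (by simp)).1⟩
    have h3 : IsTri M (f 0) (f 3) (f 4) := ⟨by grind, ((hC _).2 (by simp)).1⟩
    have h4 := h1.swap
    have h5 := h2.swap
    have h6 := h3.swap
    clear hC
    rintro (⟨rfl, rfl⟩ | ⟨rfl, rfl⟩ | ⟨rfl, rfl⟩ | ⟨rfl, rfl⟩ | ⟨rfl, rfl⟩ | ⟨rfl, rfl⟩) <;>
      assumption
  · have h4 := card_four h
    rcases (hC _).1 ⟨h', by simp [verts_cycleEdges]⟩ with e | e | e | e | e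
    · rw [e, card_three (by grind)] at h4; omega
    · rw [e, card_three (by grind)] at h4; omega
    · have := cycleEdges_four_inj h (by grind) e; grind
    · rw [e, card_three (by grind)] at h4; omega
    · have := cycleEdges_four_inj h (by grind) e; grind
  · have h1 : IsQuad M (f 0) (f 2) (f 6) (f 3) := ⟨by grind, ((hC _).2 (by simp)).1⟩
    have h2 : IsQuad M (f 0) (f 4) (f 7) (f 5) := ⟨by grind, ((hC _).2 (by simp)).1⟩
    have h3 := h1.swap
    have h4 := h2.swap
    clear hC
    rintro (⟨rfl, rfl, rfl⟩ | ⟨rfl, rfl, rfl⟩ | ⟨rfl, rfl, rfl⟩ | ⟨rfl, rfl, rfl⟩) <;> assumption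

/-- If all faces are triangles or quadrangles, then they are the sets of edges of the triples and
quadruples that satisfy `IsTri` and `IsQuad`. -/
theorem mem_iff_isTri_or_isQuad (hM : ∀ C ∈ M, IsCycle C)
    (h : ∀ C ∈ M, C.card = 3 ∨ C.card = 4) (C : Finset (Sym2 V)) :
    C ∈ M ↔ (∃ a b c, IsTri M a b c ∧ C = cycleEdges [a, b, c]) ∨
      ∃ a b c d, IsQuad M a b c d ∧ C = cycleEdges [a, b, c, d] := by
  constructor
  · intro hC
    obtain ⟨l, hl, h3, rfl⟩ := hM C hC
    have := h _ hC
    rw [card_cycleEdges hl h3] at this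
    match l, this with
    | [a, b, c], _ => exact Or.inl ⟨a, b, c, ⟨hl, hC⟩, rfl⟩
    | [a, b, c, d], _ => exact Or.inr ⟨a, b, c, d, ⟨hl, hC⟩, rfl⟩
  · rintro (⟨a, b, c, h, rfl⟩ | ⟨a, b, c, d, h, rfl⟩) <;> exact h.2

theorem card_eq_of_hasWheel {w : List (List (Fin 8))} (hM : ∀ C ∈ M, IsCycle C)
    (hw : ∀ l ∈ w, (cycleEdges l).card = 3 ∨ (cycleEdges l).card = 4)
    (h : ∀ v, HasWheel M w v) : ∀ C ∈ M, C.card = 3 ∨ C.card = 4 := by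
  intro C hC
  obtain ⟨l, hl, h3, rfl⟩ := hM C hC
  match l, h3 with
  | v :: l, _ =>
    obtain ⟨f, hf, -, hfC⟩ := h v
    obtain ⟨l', hl', h'⟩ := (hfC _).1 ⟨hC, by simp [verts_cycleEdges]⟩
    rw [h', cycleEdges_map, card_image_of_injective _ (Sym2.map.injective hf)]
    exact hw l' hl'

end Local

/-- The scheme of the maps of type `(3³, 4²)`. A corner `x` is a quadrangle `abcd` such that `ab`
is an edge of a triangle; `1` and `2` move it to `badc` and `dcba`, and `tau` moves it to the
corner at `e` in the direction of `f`, when `abe` and `aef` are triangles. -/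
def scheme33344 : Scheme where
  op := Nat.xor
  -- Both words solve the relation that `mate` (the word `[4, 1, 4]`) commutes with `2` for one
  -- occurrence of `tau`.
  forced := [[1, 4, 2, 4, 1, 4, 2], [2, 4, 1, 4, 2, 4, 1]]
  -- Each pair leads to two different vertices of one wheel.
  distinct := [([3], [4]), ([2], [4, 1, 4]), ([2], [4]), ([4, 1, 4, 1], [1, 4]),
    ([4, 1, 4, 3], [1, 4, 1, 4]), ([4, 1, 4, 3], [3, 4, 1, 4]), ([4, 1, 4, 3], [1, 4])]
  mate := [4, 1, 4]
  polygons := [[[], [1], [3], [2]], [[], [1], [4]]]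

theorem lawful_scheme33344 : scheme33344.Lawful where
  op_lt := by decide
  exists_inv := by decide
  forced_le := by decide
  distinct_le := by decide
  mate_le := by decide
  polygons_le := by decide

/-! ### The corners of a map of type (3³, 4²) as a gluing. -/

section Corner33344

variable {V : Type*} [DecidableEq V]

/-- A corner of a quadrangle, with the edge of the quadrangle that lies in a triangle. -/
@[ext]
structure Corner33344 (M : Finset (Finset (Sym2 V))) where
  a : V
  b : V
  c : V
  d : V
  quad : IsQuad M a b c d
  tri : ∃ e, IsTri M a b e

variable {M : Finset (Finset (Sym2 V))} (hw : ∀ v, HasWheel M wheel33344 v)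

namespace Corner33344

include hw

/-- Up to the reflection of the wheel there is one position for `x`, since its edge `ab` lies in a
triangle and so is not the edge common to the two quadrangles. Around `a` the triangles are `abe`,
`aee'`, `ae'b'`, and the second quadrangle is `adc'b'`. -/
theorem wheel (x : Corner33344 M) : ∃ b' e e' c', [x.a, x.b, x.c, x.d, b', c', e, e'].Nodup ∧
    (∀ s t, IsTri M x.a s t ↔ (s = b' ∧ t = e') ∨ (s = e' ∧ t = b') ∨ (s = e' ∧ t = e) ∨
      (s = e ∧ t = e') ∨ (s = e ∧ t = x.b) ∨ (s = x.b ∧ t = e)) ∧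
    ∀ s t r, IsQuad M x.a s t r ↔ (s = x.b ∧ t = x.c ∧ r = x.d) ∨ (s = x.d ∧ t = x.c ∧ r = x.b) ∨
      (s = x.d ∧ t = c' ∧ r = b') ∨ (s = b' ∧ t = c' ∧ r = x.d) := by
  obtain ⟨p, q, r, s, t, y, z, hnd, hT, hQ⟩ := (hw x.a).exists_33344
  obtain ⟨e, he⟩ := x.tri
  rw [hT] at he
  have hq := (hQ _ _ _).1 x.quad
  rcases hq with h | h | h | h
  · refine ⟨t, q, p, z, by grind, fun _ _ => ?_, fun _ _ _ => ?_⟩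
    · rw [hT]; grind
    · rw [hQ]; grind
  · grind
  · grind
  · refine ⟨r, p, q, y, by grind, fun _ _ => ?_, fun _ _ _ => ?_⟩
    · rw [hT]; grind
    · rw [hQ]; grind

theorem ext' {x y : Corner33344 M} (ha : x.a = y.a) (hb : x.b = y.b) : x = y := by
  obtain ⟨b', e, e', c', hnd, hT, hQ⟩ := x.wheel hw
  have := (hQ y.b y.c y.d).1 (ha ▸ y.quad)
  ext <;> grind

omit hw in
/-- The other corner at the same edge. -/
def flip (x : Corner33344 M) : Corner33344 M :=
  ⟨x.b, x.a, x.d, x.c, x.quad.swap.rotate.rotate.rotate,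
    x.tri.imp fun _ h => h.swap.rotate.rotate⟩

/-- At `d` one of the two edges of the quadrangle lies in a triangle. It is not `da`, which at `a`
is seen to lie in no triangle, so it is `dc`. -/
theorem exists_isTri_opposite (x : Corner33344 M) : ∃ e, IsTri M x.d x.c e := by
  obtain ⟨b', e, e', c', hnd, hT, hQ⟩ := x.wheel hw
  obtain ⟨p, q, r, s, t, y, z, hnd', hT', hQ'⟩ := (hw x.d).exists_33344
  have h1 := (hQ' _ _ _).1 x.quad.swap.rotate
  have h2 : ∀ t, ¬ IsTri M x.d x.a t := fun t ht => by
    have := (hT _ _).1 ht.rotate.swap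
    grind
  rcases h1 with ⟨h, -, h'⟩ | ⟨h, -, h'⟩ | ⟨h, -, h'⟩ | ⟨h, -, h'⟩
  · exact ⟨q, (hT' _ _).2 (by simp [h])⟩
  · exact absurd ((hT' _ _).2 (by simp [h'])) (h2 q)
  · exact absurd ((hT' _ _).2 (by simp [h'])) (h2 p)
  · exact ⟨p, (hT' _ _).2 (by simp [h])⟩

/-- The corner at the other end of the edge that joins two quadrangles. -/
def opposite (x : Corner33344 M) : Corner33344 M :=
  ⟨x.d, x.c, x.b, x.a, x.quad.swap.rotate, x.exists_isTri_opposite hw⟩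

omit hw in
/-- The corner `y` lies across a triangle from `x`. -/
def Glued (x y : Corner33344 M) : Prop :=
  IsTri M x.a x.b y.a ∧ IsTri M x.a y.a y.b ∧ y.b ≠ x.b

omit hw in
theorem Glued.symm {x y : Corner33344 M} (h : x.Glued y) : y.Glued x :=
  ⟨h.2.1.rotate, h.1.rotate.rotate, h.2.2.symm⟩

theorem Glued.unique {x y z : Corner33344 M} (hy : x.Glued y) (hz : x.Glued z) : y = z := by
  obtain ⟨b', e, e', c', hnd, hT, hQ⟩ := x.wheel hw
  obtain ⟨h1, h2, h3⟩ := hy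
  obtain ⟨h4, h5, h6⟩ := hz
  rw [hT] at h1 h2 h4 h5
  simp only [List.nodup_cons, List.mem_cons, List.not_mem_nil, or_false, not_or] at hnd
  exact ext' hw (by grind) (by grind)

/-- Let `e` be the third vertex of the triangle on `ab`. The triangles next to it across `ae` and
`be` also contain `e`, so `abe` is the middle one of the three triangles at `e`. Hence the far edge
`ee'` of the neighbour across `ae` is an edge of a quadrangle. -/
theorem exists_glued (x : Corner33344 M) : ∃ y, x.Glued y := by
  obtain ⟨b', e, e', c', hnd, hT, hQ⟩ := x.wheel hw
  obtain ⟨b₁, e₁, e₁', c₁, hnd₁, hT₁, hQ₁⟩ := x.flip.wheel hw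
  obtain ⟨p, q, r, s, t, y, z, hnd₂, hT₂, hQ₂⟩ := (hw e).exists_33344
  have h1 : IsTri M x.a x.b e := (hT _ _).2 (by simp)
  have h2 : IsTri M x.a e e' := (hT _ _).2 (by simp)
  have h3 : e₁ = e := by
    have := (hT₁ x.a e).1 h1.rotate.swap
    simp only [flip, List.nodup_cons, List.mem_cons, List.not_mem_nil, or_false, not_or] at *
    grind
  have h4 : IsTri M x.b e e₁' := (hT₁ _ _).2 (by simp [h3])
  have h5 : e' ≠ x.b ∧ e₁' ≠ x.a := by
    simp only [flip, List.nodup_cons, List.mem_cons, List.not_mem_nil, or_false, not_or] at *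
    grind
  have k1 := (hT₂ _ _).1 h1.rotate.rotate
  have k2 := (hT₂ _ _).1 h2.rotate
  have k3 := (hT₂ _ _).1 h4.rotate
  obtain ⟨u, v, huv⟩ : ∃ u v, IsQuad M e e' u v := by
    have : e' = r ∨ e' = t := by
      simp only [List.nodup_cons, List.mem_cons, List.not_mem_nil, or_false, not_or] at hnd₂
      grind
    rcases this with rfl | rfl
    · exact ⟨_, _, (hQ₂ _ _ _).2 (Or.inl ⟨rfl, rfl, rfl⟩)⟩
    · exact ⟨_, _, (hQ₂ _ _ _).2 (Or.inr (Or.inr (Or.inr ⟨rfl, rfl, rfl⟩)))⟩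
  exact ⟨⟨e, e', u, v, huv, x.a, h2.rotate⟩, h1, h2, h5.1⟩

/-- The corner across the triangle. -/
noncomputable def glue (x : Corner33344 M) : Corner33344 M := (x.exists_glued hw).choose

theorem glued_glue (x : Corner33344 M) : x.Glued (x.glue hw) := (x.exists_glued hw).choose_spec

theorem glue_eq {x y : Corner33344 M} (h : x.Glued y) : x.glue hw = y :=
  (x.glued_glue hw).unique hw h

theorem glue_glue (x : Corner33344 M) : (x.glue hw).glue hw = x :=
  glue_eq hw (x.glued_glue hw).symm

/-- The other corner at the same vertex. -/
noncomputable def mate (x : Corner33344 M) : Corner33344 M := (x.glue hw).flip.glue hw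

/-- Both corners on the edge `ab` see the same triangle. -/
theorem glue_flip_a (x : Corner33344 M) : (x.flip.glue hw).a = (x.glue hw).a := by
  obtain ⟨b', e, e', c', hnd, hT, hQ⟩ := x.wheel hw
  have h1 := (x.glued_glue hw).1
  have h2 : IsTri M x.a x.b (x.flip.glue hw).a := (x.flip.glued_glue hw).1.rotate.swap
  rw [hT] at h1 h2
  simp only [List.nodup_cons, List.mem_cons, List.not_mem_nil, or_false, not_or] at hnd
  grind

theorem mate_a (x : Corner33344 M) : (x.mate hw).a = x.a := by
  rw [mate, glue_flip_a, glue_glue]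

/-- The faces around the vertex at a corner, in terms of the other corners. -/
theorem wheel_glue (x : Corner33344 M) :
    [x.a, x.b, x.c, x.d, (x.mate hw).b, (x.mate hw).c, (x.glue hw).a, (x.glue hw).b].Nodup ∧
    (x.mate hw).d = x.d ∧
    (∀ s t, IsTri M x.a s t → (s = (x.mate hw).b ∧ t = (x.glue hw).b) ∨
      (s = (x.glue hw).b ∧ t = (x.mate hw).b) ∨ (s = (x.glue hw).b ∧ t = (x.glue hw).a) ∨
      (s = (x.glue hw).a ∧ t = (x.glue hw).b) ∨ (s = (x.glue hw).a ∧ t = x.b) ∨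
      (s = x.b ∧ t = (x.glue hw).a)) ∧
    IsTri M x.a x.b (x.glue hw).a ∧
    ∀ s t r, IsQuad M x.a s t r → s = x.b ∨ s = x.d ∨ s = (x.mate hw).b := by
  obtain ⟨b', e, e', c', hnd, hT, hQ⟩ := x.wheel hw
  have hm := x.mate_a hw
  obtain ⟨h1, h2, h3⟩ := x.glued_glue hw
  obtain ⟨-, h5, h6⟩ := (x.glue hw).flip.glued_glue hw
  have hq := (hQ _ _ _).1 (hm ▸ (x.mate hw).quad)
  have h1' := (hT _ _).1 h1
  rw [← mate, hm] at h5
  have h5' := (hT _ _).1 (IsTri.swap (IsTri.rotate h5))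
  rw [hT] at h2
  change (x.mate hw).b ≠ (x.glue hw).a at h6
  change ((x.glue hw).b = _ ∧ (x.mate hw).b = _) ∨ ((x.glue hw).b = _ ∧ _) ∨
    ((x.glue hw).b = _ ∧ _) ∨ ((x.glue hw).b = _ ∧ _) ∨ ((x.glue hw).b = _ ∧ _) ∨
    ((x.glue hw).b = _ ∧ _) at h5'
  simp only [List.nodup_cons, List.mem_cons, List.not_mem_nil, or_false, not_or] at hnd
  have e1 : (x.glue hw).a = e := by grind
  have e2 : (x.glue hw).b = e' := by grind
  have e3 : (x.mate hw).b = b' := by grind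
  have e4 : (x.mate hw).c = c' ∧ (x.mate hw).d = x.d := by grind
  refine ⟨?_, e4.2, ?_, h1, ?_⟩
  · rw [e1, e2, e3, e4.1]
    simp only [List.nodup_cons, List.mem_cons, List.not_mem_nil, or_false, not_or]
    exact hnd
  · rw [e1, e2, e3]
    exact fun s t => (hT s t).1
  · rw [e3]
    intro s t r h
    have := (hQ s t r).1 h
    grind

theorem eq_or_eq_mate {x y : Corner33344 M} (h : x.a = y.a) : y = x ∨ y = x.mate hw := by
  obtain ⟨hnd, hd, hT, -, hQ⟩ := x.wheel_glue hw
  obtain ⟨e, he⟩ := y.tri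
  have h1 := hQ _ _ _ (h ▸ y.quad)
  have h2 := hT _ _ (h ▸ he)
  simp only [List.nodup_cons, List.mem_cons, List.not_mem_nil, or_false, not_or] at hnd
  rcases (by grind : y.b = x.b ∨ y.b = (x.mate hw).b) with h3 | h3
  · exact Or.inl (ext' hw h.symm h3)
  · exact Or.inr (ext' hw (h.symm.trans (x.mate_a hw).symm) h3)

/-- The two quadrangles at `a` share the edge `ad`, so both sides are corners at `d`. They lie in
different quadrangles, as their vertices next to `a` differ. This is the relation behind
`scheme33344.forced`. -/
theorem mate_opposite (x : Corner33344 M) : (x.opposite hw).mate hw = (x.mate hw).opposite hw := by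
  rcases eq_or_eq_mate hw (x := x.opposite hw) (y := (x.mate hw).opposite hw)
    (x.wheel_glue hw).2.1.symm with h | h
  · have h1 := congrArg Corner33344.c h
    have := (x.wheel_glue hw).1
    simp only [opposite] at h1
    rw [h1] at this
    grind
  · exact h.symm

theorem exists_corner (v : V) : ∃ x : Corner33344 M, x.a = v := by
  obtain ⟨p, q, r, s, t, y, z, hnd, hT, hQ⟩ := (hw v).exists_33344
  exact ⟨⟨v, r, y, s, (hQ _ _ _).2 (by simp), q, (hT _ _).2 (by simp)⟩, rfl⟩

/-- The action of the group of order four on the corners of a quadrangle. -/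
def act : ℕ → Corner33344 M → Corner33344 M
  | 1, x => x.flip
  | 2, x => x.opposite hw
  | 3, x => (x.opposite hw).flip
  | _, x => x

/-- The corners of a map of type `(3³, 4²)` as a gluing. -/
noncomputable def realization
    (hM : ∀ C, C ∈ M ↔ (∃ a b c, IsTri M a b c ∧ C = cycleEdges [a, b, c]) ∨
      ∃ a b c d, IsQuad M a b c d ∧ C = cycleEdges [a, b, c, d]) :
    Realization scheme33344 M (Corner33344 M) where
  act := act hw
  tau := glue hw
  act_zero _ := rfl
  act_act i hi j hj x := by
    interval_cases i <;> interval_cases j <;> rfl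
  act_free i hi j hj x h := by
    have h := congrArg Corner33344.a h
    have := x.quad.ne
    interval_cases i <;> interval_cases j <;> first | rfl | (simp only [act, flip, opposite] at h; grind)
  tau_tau := glue_glue hw
  tau_ne x h := by
    have := (x.wheel_glue hw).1
    rw [h] at this
    simp at this
  forced := by
    have hcomm : ∀ x : Corner33344 M, ((((x.opposite hw).glue hw).flip.glue hw)) =
        ((x.glue hw).flip.glue hw).opposite hw := mate_opposite hw
    have hinv : ∀ x : Corner33344 M, (x.opposite hw).opposite hw = x := fun _ => rfl
    have hinv' : ∀ x : Corner33344 M, x.flip.flip = x := fun _ => rfl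
    intro w hw' x
    simp only [scheme33344, List.mem_cons, List.not_mem_nil, or_false] at hw'
    rcases hw' with rfl | rfl
    · change ((((((x.flip.glue hw).opposite hw).glue hw).flip.glue hw).opposite hw)) = _
      rw [hcomm, hinv, glue_glue, hinv']
    · change (((((x.opposite hw).glue hw).flip.glue hw).opposite hw).glue hw).flip = _
      rw [hcomm, hinv, glue_glue, hinv']
  distinct := by
    intro p hp x h
    have h := congrArg Corner33344.a h
    obtain ⟨hnd, -⟩ := x.wheel_glue hw
    simp only [List.nodup_cons, List.mem_cons, List.not_mem_nil, or_false, not_or] at hnd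
    simp only [scheme33344, List.mem_cons, List.not_mem_nil, or_false] at hp
    rcases hp with rfl | rfl | rfl | rfl | rfl | rfl | rfl
    · change x.c = (x.glue hw).a at h
      grind
    · change x.d = (x.mate hw).a at h
      rw [mate_a] at h
      grind
    · change x.d = (x.glue hw).a at h
      grind
    · change (x.mate hw).b = (x.flip.glue hw).a at h
      rw [glue_flip_a] at h
      grind
    · change (x.mate hw).c = (x.flip.mate hw).a at h
      rw [mate_a] at h
      change _ = x.b at h
      grind
    · change (x.mate hw).c = ((x.opposite hw).flip.mate hw).a at h
      rw [mate_a] at h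
      change _ = x.c at h
      grind
    · change (x.mate hw).c = (x.flip.glue hw).a at h
      rw [glue_flip_a] at h
      grind
  vert := Corner33344.a
  vert_eq_iff x y := ⟨eq_or_eq_mate hw, by
    rintro (rfl | rfl)
    · rfl
    · exact (x.mate_a hw).symm⟩
  face_iff C := by
    change C ∈ M ↔ ∃ x : Corner33344 M, ∃ p ∈ [[[], [1], [3], [2]], [[], [1], [4]]], _
    simp only [List.mem_cons, List.not_mem_nil, or_false, exists_eq_or_imp, exists_eq_left]
    change C ∈ M ↔ ∃ x : Corner33344 M, C = cycleEdges [x.a, x.b, x.c, x.d] ∨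
      C = cycleEdges [x.a, x.b, (x.glue hw).a]
    constructor
    · rw [hM]
      rintro (⟨a, b, c, h, rfl⟩ | ⟨a, b, c, d, h, rfl⟩)
      · obtain ⟨x, rfl⟩ := exists_corner hw a
        obtain ⟨-, -, hT, -⟩ := x.wheel_glue hw
        have hm : (x.mate hw).glue hw = (x.glue hw).flip := glue_glue hw _
        have hma := x.mate_a hw
        rcases hT _ _ h with ⟨rfl, rfl⟩ | ⟨rfl, rfl⟩ | ⟨rfl, rfl⟩ | ⟨rfl, rfl⟩ | ⟨rfl, rfl⟩ |
          ⟨rfl, rfl⟩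
        · exact ⟨x.mate hw, Or.inr (by rw [hm, hma]; rfl)⟩
        · exact ⟨x.mate hw, Or.inr (by rw [hm, hma, cycleEdges_three_swap]; rfl)⟩
        · exact ⟨x.glue hw, Or.inr (by
            rw [glue_glue, cycleEdges_three_swap, cycleEdges_three_rotate])⟩
        · exact ⟨x.glue hw, Or.inr (by rw [glue_glue, cycleEdges_three_rotate])⟩
        · exact ⟨x, Or.inr (cycleEdges_three_swap _ _ _)⟩
        · exact ⟨x, Or.inr rfl⟩
      · obtain ⟨p, q, r, s, t, y, z, hnd, hT, hQ⟩ := (hw a).exists_33344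
        rcases (hQ _ _ _).1 h with ⟨rfl, -⟩ | ⟨-, -, rfl⟩ | ⟨-, -, rfl⟩ | ⟨rfl, -⟩
        · exact ⟨⟨_, _, _, _, h, q, (hT _ _).2 (by simp)⟩, Or.inl rfl⟩
        · exact ⟨⟨_, _, _, _, h.swap, q, (hT _ _).2 (by simp)⟩, Or.inl (cycleEdges_four_swap ..)⟩
        · exact ⟨⟨_, _, _, _, h.swap, p, (hT _ _).2 (by simp)⟩, Or.inl (cycleEdges_four_swap ..)⟩
        · exact ⟨⟨_, _, _, _, h, p, (hT _ _).2 (by simp)⟩, Or.inl rfl⟩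
    · rintro ⟨x, rfl | rfl⟩
      · exact x.quad.2
      · exact (x.glued_glue hw).1.2

end Corner33344

end Corner33344

/-- The scheme of the maps of type `(3², 4, 3, 4)`. A corner `x` is a quadrangle `abcd` such that
`ab` and another edge `ae` of a quadrangle span a triangle; `1` moves it to `bcda`, and `tau`
moves it to the corner at `a` in the direction of `e`. -/
def scheme33434 : Scheme where
  op i j := (i + j) % 4
  -- Both words solve the relation `across_mate` for one occurrence of `tau`; `[3, 4, 1]` is the
  -- word of `across`.
  forced := [[1, 4, 3, 4, 1, 4, 3], [3, 4, 1, 4, 3, 4, 1]]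
  distinct := [([4, 2], [2, 4]), ([4, 3], [1, 4]), ([4, 3], [2, 4]), ([3, 4, 1], [4]),
    ([3, 4, 1], [4, 3, 4])]
  mate := [4]
  polygons := [[[], [1], [2], [3]], [[], [1], [4, 1]]]

theorem lawful_scheme33434 : scheme33434.Lawful where
  op_lt := by decide
  exists_inv := by decide
  forced_le := by decide
  distinct_le := by decide
  mate_le := by decide
  polygons_le := by decide

/-! ### The corners of a map of type (3², 4, 3, 4) as a gluing. -/

section Corner33434

variable {V : Type*} [DecidableEq V]

/-- The edge `ab` lies in a triangle `abe` such that `ae` is an edge of a quadrangle. -/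
def IsApexEdge (M : Finset (Finset (Sym2 V))) (a b : V) : Prop :=
  ∃ e y z, IsTri M a b e ∧ IsQuad M a e y z

variable {M : Finset (Finset (Sym2 V))} (hw : ∀ v, HasWheel M wheel33434 v)

section Wheel

include hw

/-- The wheel at a vertex, with the edges that satisfy `IsApexEdge`. -/
theorem exists_wheel33434 (v : V) : ∃ p q r s t y z, [v, p, q, r, s, t, y, z].Nodup ∧
    (∀ a b, IsTri M v a b ↔ (a = t ∧ b = p) ∨ (a = p ∧ b = t) ∨ (a = p ∧ b = q) ∨
      (a = q ∧ b = p) ∨ (a = r ∧ b = s) ∨ (a = s ∧ b = r)) ∧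
    (∀ a b c, IsQuad M v a b c ↔ (a = q ∧ b = y ∧ c = r) ∨ (a = r ∧ b = y ∧ c = q) ∨
      (a = s ∧ b = z ∧ c = t) ∨ (a = t ∧ b = z ∧ c = s)) ∧
    ∀ a b c, IsQuad M v a b c → (IsApexEdge M v a ↔ a = r ∨ a = s) := by
  obtain ⟨p, q, r, s, t, y, z, hnd, hT, hQ⟩ := (hw v).exists_33434
  refine ⟨p, q, r, s, t, y, z, hnd, hT, hQ, fun a b c h => ?_⟩
  rw [hQ] at h
  simp only [List.nodup_cons, List.mem_cons, List.not_mem_nil, or_false, not_or] at hnd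
  constructor
  · rintro ⟨e, u, w, h1, h2⟩
    rw [hT] at h1
    rw [hQ] at h2
    grind
  · rintro (rfl | rfl)
    · exact ⟨s, z, t, (hT _ _).2 (by simp), (hQ _ _ _).2 (by simp)⟩
    · exact ⟨r, y, q, (hT _ _).2 (by simp), (hQ _ _ _).2 (by simp)⟩

/-- At a vertex each quadrangle lies between the isolated triangle and one of the two adjacent
triangles; only its edge in the isolated triangle qualifies. -/
theorem isApexEdge_iff_not {a b c d : V} (h : IsQuad M a b c d) :
    IsApexEdge M a b ↔ ¬ IsApexEdge M a d := by
  obtain ⟨p, q, r, s, t, y, z, hnd, hT, hQ, hE⟩ := exists_wheel33434 hw a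
  rw [hE _ _ _ h, hE _ _ _ h.swap]
  rw [hQ] at h
  simp only [List.nodup_cons, List.mem_cons, List.not_mem_nil, or_false, not_or] at hnd
  grind

/-- Otherwise the triangle on `ab` belongs, both at `a` and at `b`, to the adjacent pair, so its
sides from `a` and `b` to the third vertex `p` lie in no quadrangle. But every triangle at `p` has a
side at `p` that lies in a quadrangle. -/
theorem isApexEdge_or {a b c d : V} (h : IsQuad M a b c d) :
    IsApexEdge M a b ∨ IsApexEdge M b a := by
  by_contra hne
  push Not at hne
  obtain ⟨p, q, r, s, t, y, z, hnd, hT, hQ, hE⟩ := exists_wheel33434 hw a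
  obtain ⟨p', q', r', s', t', y', z', hnd', hT', hQ', hE'⟩ := exists_wheel33434 hw b
  obtain ⟨p₂, q₂, r₂, s₂, t₂, y₂, z₂, hnd₂, hT₂, hQ₂, -⟩ := exists_wheel33434 hw p
  have h' := h.swap.rotate.rotate.rotate
  rw [hE _ _ _ h, hE' _ _ _ h'] at hne
  rw [hQ] at h
  rw [hQ'] at h'
  have h1 : IsTri M a b p := (hT _ _).2 (by grind)
  have h2 := (hT' _ _).1 h1.rotate.swap
  have hp : p = p' := by
    simp only [List.nodup_cons, List.mem_cons, List.not_mem_nil, or_false, not_or] at hnd'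
    grind
  have h3 := (hT₂ _ _).1 h1.rotate.rotate
  have h4 : ∀ u w, ¬ IsQuad M p a u w := fun u w hq => by
    have := (hQ _ _ _).1 hq.swap.rotate.rotate.rotate
    simp only [List.nodup_cons, List.mem_cons, List.not_mem_nil, or_false, not_or] at hnd
    grind
  have h5 : ∀ u w, ¬ IsQuad M p b u w := fun u w hq => by
    have := (hQ' _ _ _).1 hq.swap.rotate.rotate.rotate
    simp only [List.nodup_cons, List.mem_cons, List.not_mem_nil, or_false, not_or] at hnd'
    grind
  have k1 : ∃ u w, IsQuad M p q₂ u w := ⟨_, _, (hQ₂ _ _ _).2 (Or.inl ⟨rfl, rfl, rfl⟩)⟩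
  have k2 : ∃ u w, IsQuad M p r₂ u w := ⟨_, _, (hQ₂ _ _ _).2 (Or.inr (Or.inl ⟨rfl, rfl, rfl⟩))⟩
  have k3 : ∃ u w, IsQuad M p s₂ u w :=
    ⟨_, _, (hQ₂ _ _ _).2 (Or.inr (Or.inr (Or.inl ⟨rfl, rfl, rfl⟩)))⟩
  have k4 : ∃ u w, IsQuad M p t₂ u w :=
    ⟨_, _, (hQ₂ _ _ _).2 (Or.inr (Or.inr (Or.inr ⟨rfl, rfl, rfl⟩)))⟩
  have ha : ∀ v, a = v → ¬ ∃ u w, IsQuad M p v u w := by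
    rintro v rfl ⟨u, w, hq⟩
    exact h4 u w hq
  have hb : ∀ v, b = v → ¬ ∃ u w, IsQuad M p v u w := by
    rintro v rfl ⟨u, w, hq⟩
    exact h5 u w hq
  rcases h3 with ⟨e, -⟩ | ⟨-, e⟩ | ⟨-, e⟩ | ⟨e, -⟩ | ⟨e, -⟩ | ⟨e, -⟩
  exacts [ha _ e k4, hb _ e k4, hb _ e k1, ha _ e k1, ha _ e k2, ha _ e k3]

/-- Along the edges of a quadrangle, those that satisfy `IsApexEdge` follow one another. -/
theorem IsApexEdge.next {a b c d : V} (h : IsQuad M a b c d) (hab : IsApexEdge M a b) :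
    IsApexEdge M b c := by
  -- Each of the four corners selects exactly one of its edges and each of the four edges is
  -- selected, so all selections run around in the same direction.
  have h1 := isApexEdge_iff_not hw h
  have h2 := isApexEdge_iff_not hw h.rotate
  have h3 := isApexEdge_iff_not hw h.rotate.rotate
  have h4 := isApexEdge_iff_not hw h.rotate.rotate.rotate
  have h5 := isApexEdge_or hw h
  have h6 := isApexEdge_or hw h.rotate
  have h7 := isApexEdge_or hw h.rotate.rotate
  have h8 := isApexEdge_or hw h.rotate.rotate.rotate
  tauto

end Wheel

/-- A corner of a quadrangle, with the edge at this corner that satisfies `IsApexEdge`. -/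
@[ext]
structure Corner33434 (M : Finset (Finset (Sym2 V))) where
  a : V
  b : V
  c : V
  d : V
  quad : IsQuad M a b c d
  apex : IsApexEdge M a b

namespace Corner33434

include hw

/-- The wheel is put in standard position by reflection: `abb'` is the isolated triangle, `ab'c'd'`
the other quadrangle, and `ade`, `aed'` are the adjacent triangles. -/
theorem wheel (x : Corner33434 M) : ∃ b' c' d' e, [x.a, x.b, x.c, x.d, b', c', d', e].Nodup ∧
    (∀ s t, IsTri M x.a s t ↔ (s = d' ∧ t = e) ∨ (s = e ∧ t = d') ∨ (s = e ∧ t = x.d) ∨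
      (s = x.d ∧ t = e) ∨ (s = x.b ∧ t = b') ∨ (s = b' ∧ t = x.b)) ∧
    (∀ s t r, IsQuad M x.a s t r ↔ (s = x.b ∧ t = x.c ∧ r = x.d) ∨ (s = x.d ∧ t = x.c ∧ r = x.b) ∨
      (s = b' ∧ t = c' ∧ r = d') ∨ (s = d' ∧ t = c' ∧ r = b')) ∧
    ∀ s t r, IsQuad M x.a s t r → (IsApexEdge M x.a s ↔ s = x.b ∨ s = b') := by
  obtain ⟨p, q, r, s, t, y, z, hnd, hT, hQ, hE⟩ := exists_wheel33434 hw x.a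
  have he := (hE _ _ _ x.quad).1 x.apex
  have hq := (hQ _ _ _).1 x.quad
  have hnd' := hnd
  simp only [List.nodup_cons, List.mem_cons, List.not_mem_nil, or_false, not_or] at hnd'
  rcases hq with h | h | h | h
  · grind
  · refine ⟨s, z, t, p, by grind, fun _ _ => ?_, fun _ _ _ => ?_, fun _ _ _ h => ?_⟩
    · rw [hT]; grind
    · rw [hQ]; grind
    · rw [hE _ _ _ h]; grind
  · refine ⟨r, y, q, p, by grind, fun _ _ => ?_, fun _ _ _ => ?_, fun _ _ _ h => ?_⟩
    · rw [hT]; grind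
    · rw [hQ]; grind
    · rw [hE _ _ _ h]; grind
  · grind

theorem ext' {x y : Corner33434 M} (ha : x.a = y.a) (hb : x.b = y.b) : x = y := by
  obtain ⟨b', c', d', e, hnd, hT, hQ, -⟩ := x.wheel hw
  have := (hQ y.b y.c y.d).1 (ha ▸ y.quad)
  simp only [List.nodup_cons, List.mem_cons, List.not_mem_nil, or_false, not_or] at hnd
  ext <;> grind

/-- The next corner of the quadrangle. -/
def next (x : Corner33434 M) : Corner33434 M :=
  ⟨x.b, x.c, x.d, x.a, x.quad.rotate, x.apex.next hw x.quad⟩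

theorem exists_mate (x : Corner33434 M) : ∃ y : Corner33434 M, y.a = x.a ∧ IsTri M x.a x.b y.b := by
  obtain ⟨b', c', d', e, hnd, hT, hQ, hE⟩ := x.wheel hw
  have h : IsQuad M x.a b' c' d' := (hQ _ _ _).2 (by simp)
  exact ⟨⟨x.a, b', c', d', h, (hE _ _ _ h).2 (Or.inr rfl)⟩, rfl, (hT _ _).2 (by simp)⟩

/-- The other corner at the same vertex. -/
noncomputable def mate (x : Corner33434 M) : Corner33434 M := (x.exists_mate hw).choose

theorem mate_a (x : Corner33434 M) : (x.mate hw).a = x.a := (x.exists_mate hw).choose_spec.1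

theorem isTri_mate (x : Corner33434 M) : IsTri M x.a x.b (x.mate hw).b :=
  (x.exists_mate hw).choose_spec.2

theorem eq_or_eq_mate {x y : Corner33434 M} (h : x.a = y.a) : y = x ∨ y = x.mate hw := by
  obtain ⟨b', c', d', e, hnd, hT, hQ, hE⟩ := x.wheel hw
  have h1 := (hE _ _ _ (h ▸ y.quad)).1 (h ▸ y.apex)
  have h2 := (hT _ _).1 (x.isTri_mate hw)
  simp only [List.nodup_cons, List.mem_cons, List.not_mem_nil, or_false, not_or] at hnd
  rcases h1 with h1 | h1
  · exact Or.inl (ext' hw h.symm h1)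
  · exact Or.inr (ext' hw (h.symm.trans (x.mate_a hw).symm) (by grind))

theorem mate_ne (x : Corner33434 M) : x.mate hw ≠ x := by
  intro h
  have := (x.isTri_mate hw).ne
  rw [h] at this
  exact this.2.2 rfl

theorem mate_mate (x : Corner33434 M) : (x.mate hw).mate hw = x := by
  rcases eq_or_eq_mate hw (x.mate_a hw) with h | h
  · exact absurd h.symm (x.mate_ne hw)
  · exact h.symm

/-- The corner at the third vertex of the triangle on the other side of the edge `ad`. -/
noncomputable def across (x : Corner33434 M) : Corner33434 M :=
  ((((x.next hw).next hw).next hw).mate hw).next hw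

theorem across_a (x : Corner33434 M) : IsTri M x.d x.a (x.across hw).a :=
  (((x.next hw).next hw).next hw).isTri_mate hw

theorem across_d (x : Corner33434 M) : (x.across hw).d = x.d :=
  (((x.next hw).next hw).next hw).mate_a hw

/-- The faces around the vertex at a corner, in terms of the other corners. -/
theorem wheel_mate (x : Corner33434 M) :
    [x.a, x.b, x.c, x.d, (x.mate hw).b, (x.mate hw).c, (x.mate hw).d, (x.across hw).a].Nodup ∧
    ((x.mate hw).across hw).a = (x.across hw).a ∧
    ∀ s t, IsTri M x.a s t → (s = (x.mate hw).d ∧ t = (x.across hw).a) ∨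
      (s = (x.across hw).a ∧ t = (x.mate hw).d) ∨ (s = (x.across hw).a ∧ t = x.d) ∨
      (s = x.d ∧ t = (x.across hw).a) ∨ (s = x.b ∧ t = (x.mate hw).b) ∨
      (s = (x.mate hw).b ∧ t = x.b) := by
  obtain ⟨b', c', d', e, hnd, hT, hQ, hE⟩ := x.wheel hw
  have hm := x.mate_a hw
  have h1 := (hT _ _).1 (x.isTri_mate hw)
  have h2 := (hT _ _).1 (x.across_a hw).rotate
  have h3 := (hQ _ _ _).1 (hm ▸ (x.mate hw).quad)
  have h4 := (x.mate hw).across_a hw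
  rw [hm] at h4
  have h4 := (hT _ _).1 h4.rotate.swap
  have hnd' := hnd
  simp only [List.nodup_cons, List.mem_cons, List.not_mem_nil, or_false, not_or] at hnd'
  have e1 : (x.mate hw).b = b' := by grind
  have e2 : (x.mate hw).c = c' ∧ (x.mate hw).d = d' := by grind
  have e3 : (x.across hw).a = e := by grind
  have e4 : ((x.mate hw).across hw).a = e := by grind
  rw [e1, e2.1, e2.2, e3, e4]
  exact ⟨hnd, rfl, fun s t => (hT s t).1⟩

/-- The triangles across `ad` in the two quadrangles at `a` are adjacent and share their third
vertex. The two corners found there have different vertices `d`, so they are the two corners at that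
vertex. -/
theorem across_mate (x : Corner33434 M) : x.across hw = ((x.mate hw).across hw).mate hw := by
  obtain ⟨hnd, ha, -⟩ := x.wheel_mate hw
  rcases eq_or_eq_mate hw ha with h | h
  · have := congrArg Corner33434.d h
    rw [across_d, across_d] at this
    rw [this] at hnd
    simp at hnd
  · exact h

theorem across_across (x : Corner33434 M) : (x.across hw).across hw = x :=
  congrArg (next hw) (mate_mate hw (((x.next hw).next hw).next hw))

theorem exists_corner (v : V) : ∃ x : Corner33434 M, x.a = v := by
  obtain ⟨p, q, r, s, t, y, z, hnd, hT, hQ, hE⟩ := exists_wheel33434 hw v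
  have h : IsQuad M v r y q := (hQ _ _ _).2 (by simp)
  exact ⟨⟨v, r, y, q, h, (hE _ _ _ h).2 (Or.inl rfl)⟩, rfl⟩

/-- The action of the group of order four on the corners of a quadrangle. -/
def act : ℕ → Corner33434 M → Corner33434 M
  | 1, x => x.next hw
  | 2, x => (x.next hw).next hw
  | 3, x => ((x.next hw).next hw).next hw
  | _, x => x

/-- The corners of a map of type `(3², 4, 3, 4)` as a gluing. -/
noncomputable def realization
    (hM : ∀ C, C ∈ M ↔ (∃ a b c, IsTri M a b c ∧ C = cycleEdges [a, b, c]) ∨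
      ∃ a b c d, IsQuad M a b c d ∧ C = cycleEdges [a, b, c, d]) :
    Realization scheme33434 M (Corner33434 M) where
  act := act hw
  tau := mate hw
  act_zero _ := rfl
  act_act i hi j hj x := by
    interval_cases i <;> interval_cases j <;> rfl
  act_free i hi j hj x h := by
    have h := congrArg Corner33434.a h
    have := x.quad.ne
    interval_cases i <;> interval_cases j <;>
      first | rfl | (simp only [act, next] at h; grind)
  tau_tau := mate_mate hw
  tau_ne := mate_ne hw
  forced := by
    intro w hw' x
    simp only [scheme33434, List.mem_cons, List.not_mem_nil, or_false] at hw'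
    rcases hw' with rfl | rfl
    · exact (congrArg (act hw 3) (across_mate hw (x.next hw))).symm
    · change ((x.across hw).mate hw).across hw = x.mate hw
      rw [across_mate, mate_mate, across_across]
  distinct := by
    intro p hp x h
    have h := congrArg Corner33434.a h
    obtain ⟨hnd, -⟩ := x.wheel_mate hw
    have hm := x.mate_a hw
    simp only [List.nodup_cons, List.mem_cons, List.not_mem_nil, or_false, not_or] at hnd
    simp only [scheme33434, List.mem_cons, List.not_mem_nil, or_false] at hp
    rcases hp with rfl | rfl | rfl | rfl | rfl
    · change (x.mate hw).c = (((x.next hw).next hw).mate hw).a at h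
      rw [mate_a] at h
      change _ = x.c at h
      grind
    · change (x.mate hw).d = ((x.next hw).mate hw).a at h
      rw [mate_a] at h
      change _ = x.b at h
      grind
    · change (x.mate hw).d = (((x.next hw).next hw).mate hw).a at h
      rw [mate_a] at h
      change _ = x.c at h
      grind
    · change (x.across hw).a = (x.mate hw).a at h
      grind
    · change (x.across hw).a = ((((x.mate hw).next hw).next hw).next hw |>.mate hw).a at h
      rw [mate_a] at h
      change _ = (x.mate hw).d at h
      grind
  vert := Corner33434.a
  vert_eq_iff x y := ⟨eq_or_eq_mate hw, by
    rintro (rfl | rfl)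
    · rfl
    · exact (x.mate_a hw).symm⟩
  face_iff C := by
    change C ∈ M ↔ ∃ x : Corner33434 M, ∃ p ∈ [[[], [1], [2], [3]], [[], [1], [4, 1]]], _
    simp only [List.mem_cons, List.not_mem_nil, or_false, exists_eq_or_imp, exists_eq_left]
    change C ∈ M ↔ ∃ x : Corner33434 M, C = cycleEdges [x.a, x.b, x.c, x.d] ∨
      C = cycleEdges [x.a, x.b, (x.mate hw).b]
    constructor
    · rw [hM]
      rintro (⟨a, b, c, h, rfl⟩ | ⟨a, b, c, d, h, rfl⟩)
      · obtain ⟨x, rfl⟩ := exists_corner hw a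
        obtain ⟨-, ha, hT⟩ := x.wheel_mate hw
        have hma := x.mate_a hw
        -- The triangle on the side `da` belongs to the corner at `d`, which is directed towards
        -- `a`.
        have key : ∀ y : Corner33434 M, ∃ z : Corner33434 M,
          cycleEdges [z.a, z.b, (z.mate hw).b] = cycleEdges [y.d, y.a, (y.across hw).a] :=
            fun y => ⟨((y.next hw).next hw).next hw, rfl⟩
        rcases hT _ _ h with ⟨rfl, rfl⟩ | ⟨rfl, rfl⟩ | ⟨rfl, rfl⟩ | ⟨rfl, rfl⟩ | ⟨rfl, rfl⟩ |
          ⟨rfl, rfl⟩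
        · obtain ⟨z, hz⟩ := key (x.mate hw)
          exact ⟨z, Or.inr (by
            rw [hz, ha, hma, cycleEdges_three_rotate, cycleEdges_three_swap])⟩
        · obtain ⟨z, hz⟩ := key (x.mate hw)
          exact ⟨z, Or.inr (by rw [hz, ha, hma, ← cycleEdges_three_rotate])⟩
        · obtain ⟨z, hz⟩ := key x
          exact ⟨z, Or.inr (by rw [hz, ← cycleEdges_three_rotate])⟩
        · obtain ⟨z, hz⟩ := key x
          exact ⟨z, Or.inr (by rw [hz, cycleEdges_three_rotate, cycleEdges_three_swap])⟩
        · exact ⟨x, Or.inr rfl⟩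
        · exact ⟨x, Or.inr (cycleEdges_three_swap _ _ _)⟩
      · by_cases hE : IsApexEdge M a b
        · exact ⟨⟨_, _, _, _, h, hE⟩, Or.inl rfl⟩
        · have := isApexEdge_iff_not hw h
          exact ⟨⟨_, _, _, _, h.swap, by tauto⟩, Or.inl (cycleEdges_four_swap ..)⟩
    · rintro ⟨x, rfl | rfl⟩
      · exact x.quad.2
      · exact (x.isTri_mate hw).2

end Corner33434

end Corner33434

/-! ### The given maps -/

/-- A map with `n` vertices, given by its faces, the wheels around its vertices, and the ways to
label its corners by vertices that occur in the search. -/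
structure MapData (n : ℕ) where
  faces : List (List (Fin n))
  wheels : List (List (Fin n))
  labellings : List (List (Fin n))

/-- The data of `T_1_10`. -/
def data_T_1_10 : MapData 10 where
  faces := [[5, 4, 0], [5, 0, 6], [4, 7, 3], [4, 3, 0], [7, 1, 8], [7, 8, 3], [1, 2, 9], [1, 9, 8], [2,
    5, 6], [2, 6, 9], [6, 0, 1, 7], [0, 3, 2, 1], [3, 8, 5, 2], [8, 9, 4, 5], [9, 6, 7, 4]]
  wheels := [[0, 4, 5, 6, 1, 3, 7, 2], [1, 8, 9, 2, 0, 7, 3, 6], [2, 6, 9, 1, 3, 5, 0, 8], [3, 4, 7, 8, 2,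
    0, 5, 1], [4, 0, 3, 7, 9, 5, 6, 8], [5, 0, 6, 2, 8, 4, 3, 9], [6, 2, 5, 0, 7, 9, 1, 4], [7, 3,
    8, 1, 6, 4, 0, 9], [8, 1, 7, 3, 5, 9, 2, 4], [9, 1, 2, 6, 4, 8, 7, 5]]
  labellings := [[6, 0, 7, 1, 5, 2, 8, 3, 5, 4, 8, 9, 6, 9, 7, 4, 0, 3, 1, 2]]

/-- The data of `T_1_12`. -/
def data_T_1_12 : MapData 12 where
  faces := [[5, 4, 0], [5, 0, 6], [4, 11, 3], [4, 3, 0], [11, 7, 10], [11, 10, 3], [7, 1, 8], [7, 8, 10],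
    [1, 2, 9], [1, 9, 8], [2, 5, 6], [2, 6, 9], [6, 0, 1, 7], [0, 3, 2, 1], [3, 10, 5, 2], [10, 8,
    4, 5], [8, 9, 11, 4], [9, 6, 7, 11]]
  wheels := [[0, 4, 5, 6, 1, 3, 7, 2], [1, 8, 9, 2, 0, 7, 3, 6], [2, 6, 9, 1, 3, 5, 0, 10], [3, 4, 11, 10,
    2, 0, 5, 1], [4, 0, 3, 11, 8, 5, 9, 10], [5, 0, 6, 2, 10, 4, 3, 8], [6, 2, 5, 0, 7, 9, 1, 11],
    [7, 8, 10, 11, 6, 1, 9, 0], [8, 1, 7, 10, 4, 9, 5, 11], [9, 1, 2, 6, 11, 8, 7, 4], [10, 7, 11,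
    3, 5, 8, 2, 4], [11, 3, 10, 7, 9, 4, 6, 8]]
  labellings := [[6, 0, 7, 1, 5, 2, 10, 3, 5, 4, 10, 8, 8, 9, 4, 11, 6, 9, 7, 11, 0, 3, 1, 2], [0, 6, 1, 7, 5,
    4, 10, 8, 5, 2, 10, 3, 8, 9, 4, 11, 0, 3, 1, 2, 7, 11, 6, 9]]

/-- The data of `T_2_12`. -/
def data_T_2_12 : MapData 12 where
  faces := [[8, 10, 7], [10, 2, 7], [10, 9, 2], [9, 1, 2], [9, 8, 1], [8, 7, 1], [6, 3, 11], [3, 4, 11],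
    [3, 0, 4], [0, 5, 4], [0, 6, 5], [6, 11, 5], [7, 2, 3, 6], [2, 1, 0, 3], [1, 7, 6, 0], [11, 4,
    8, 9], [4, 5, 10, 8], [5, 11, 9, 10]]
  wheels := [[0, 4, 5, 6, 1, 3, 7, 2], [1, 8, 9, 2, 0, 7, 3, 6], [2, 9, 10, 7, 3, 1, 6, 0], [3, 4, 11, 6,
    2, 0, 7, 1], [4, 0, 3, 11, 8, 5, 9, 10], [5, 0, 6, 11, 10, 4, 9, 8], [6, 5, 11, 3, 7, 0, 2,
    1], [7, 8, 10, 2, 6, 1, 3, 0], [8, 1, 7, 10, 4, 9, 5, 11], [9, 1, 2, 10, 11, 8, 5, 4], [10, 2,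
    7, 8, 5, 9, 4, 11], [11, 3, 6, 5, 9, 4, 10, 8]]
  labellings := [[7, 2, 6, 3, 10, 8, 5, 4, 10, 9, 5, 11, 11, 4, 9, 8, 7, 1, 6, 0, 0, 3, 1, 2], [2, 7, 3, 6,
    10, 9, 5, 11, 10, 8, 5, 4, 11, 4, 9, 8, 2, 1, 3, 0, 6, 0, 7, 1]]

/-- The data of `T_3_12`. -/
def data_T_3_12 : MapData 12 where
  faces := [[8, 10, 7], [10, 2, 7], [10, 9, 2], [9, 1, 2], [9, 8, 1], [8, 7, 1], [6, 3, 11], [3, 4, 11],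
    [3, 0, 4], [0, 5, 4], [0, 6, 5], [6, 11, 5], [7, 2, 3, 6], [2, 1, 0, 3], [1, 7, 6, 0], [11, 4,
    9, 10], [4, 5, 8, 9], [5, 11, 10, 8]]
  wheels := [[0, 4, 5, 6, 1, 3, 7, 2], [1, 8, 9, 2, 0, 7, 3, 6], [2, 9, 10, 7, 3, 1, 6, 0], [3, 4, 11, 6,
    2, 0, 7, 1], [4, 0, 3, 11, 9, 5, 10, 8], [5, 0, 6, 11, 8, 4, 10, 9], [6, 5, 11, 3, 7, 0, 2,
    1], [7, 8, 10, 2, 6, 1, 3, 0], [8, 1, 7, 10, 5, 9, 11, 4], [9, 1, 2, 10, 4, 8, 11, 5], [10, 2,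
    7, 8, 11, 9, 5, 4], [11, 3, 6, 5, 10, 4, 8, 9]]
  labellings := [[7, 2, 6, 3, 10, 8, 11, 5, 10, 9, 11, 4, 7, 1, 6, 0, 2, 1, 3, 0, 8, 9, 5, 4]]

/-- The data of `T_1_14`. -/
def data_T_1_14 : MapData 14 where
  faces := [[5, 4, 0], [5, 0, 6], [4, 7, 3], [4, 3, 0], [7, 1, 8], [7, 8, 3], [1, 2, 9], [1, 9, 8], [2,
    11, 10], [2, 10, 9], [11, 12, 13], [11, 13, 10], [12, 5, 6], [12, 6, 13], [6, 0, 1, 7], [0, 3,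
    2, 1], [3, 8, 11, 2], [8, 9, 12, 11], [9, 10, 5, 12], [10, 13, 4, 5], [13, 6, 7, 4]]
  wheels := [[0, 4, 5, 6, 1, 3, 7, 2], [1, 8, 9, 2, 0, 7, 3, 6], [2, 9, 10, 11, 3, 1, 8, 0], [3, 4, 7, 8,
    2, 0, 11, 1], [4, 0, 3, 7, 13, 5, 6, 10], [5, 0, 6, 12, 10, 4, 9, 13], [6, 5, 12, 13, 7, 0, 4,
    1], [7, 3, 8, 1, 6, 4, 0, 13], [8, 1, 7, 3, 11, 9, 2, 12], [9, 1, 2, 10, 12, 8, 5, 11], [10,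
    2, 11, 13, 5, 9, 4, 12], [11, 10, 13, 12, 8, 2, 9, 3], [12, 6, 13, 11, 9, 5, 8, 10], [13, 11,
    12, 6, 4, 10, 7, 5]]
  labellings := [[6, 0, 7, 1, 5, 12, 10, 9, 5, 4, 10, 13, 8, 3, 11, 2, 8, 9, 11, 12, 6, 13, 7, 4, 2, 1, 3, 0],
    [0, 6, 1, 7, 5, 4, 10, 13, 5, 12, 10, 9, 8, 9, 11, 12, 8, 3, 11, 2, 0, 3, 1, 2, 6, 13, 7, 4]]

/-- The data of `T_2_14`. -/
def data_T_2_14 : MapData 14 where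
  faces := [[5, 4, 0], [5, 0, 6], [4, 13, 3], [4, 3, 0], [13, 7, 12], [13, 12, 3], [7, 1, 8], [7, 8, 12],
    [1, 2, 9], [1, 9, 8], [2, 11, 10], [2, 10, 9], [11, 5, 6], [11, 6, 10], [6, 0, 1, 7], [0, 3,
    2, 1], [3, 12, 11, 2], [12, 8, 5, 11], [8, 9, 4, 5], [9, 10, 13, 4], [10, 6, 7, 13]]
  wheels := [[0, 4, 5, 6, 1, 3, 7, 2], [1, 8, 9, 2, 0, 7, 3, 6], [2, 9, 10, 11, 3, 1, 12, 0], [3, 4, 13,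
    12, 2, 0, 11, 1], [4, 0, 3, 13, 9, 5, 10, 8], [5, 0, 6, 11, 8, 4, 12, 9], [6, 5, 11, 10, 7, 0,
    13, 1], [7, 8, 12, 13, 6, 1, 10, 0], [8, 1, 7, 12, 5, 9, 11, 4], [9, 1, 2, 10, 4, 8, 13, 5],
    [10, 2, 11, 6, 13, 9, 7, 4], [11, 6, 10, 2, 12, 5, 3, 8], [12, 7, 13, 3, 11, 8, 2, 5], [13, 3,
    12, 7, 10, 4, 6, 9]]
  labellings := [[6, 0, 7, 1, 5, 11, 8, 12, 5, 4, 8, 9, 6, 10, 7, 13, 0, 3, 1, 2, 11, 2, 12, 3, 4, 13, 9, 10]]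

/-- The data of `K_1_10`. -/
def data_K_1_10 : MapData 10 where
  faces := [[5, 6, 0], [4, 0, 3], [6, 3, 5], [5, 4, 0], [4, 6, 3], [8, 7, 1], [9, 1, 2], [7, 2, 8], [8,
    9, 1], [9, 7, 2], [8, 9, 4, 5], [9, 7, 6, 4], [6, 0, 1, 7], [0, 3, 2, 1], [3, 5, 8, 2]]
  wheels := [[0, 4, 5, 6, 1, 3, 7, 2], [1, 8, 9, 2, 0, 7, 3, 6], [2, 7, 9, 1, 3, 8, 0, 5], [3, 4, 6, 5, 2,
    0, 8, 1], [4, 0, 3, 6, 9, 5, 7, 8], [5, 0, 6, 3, 8, 4, 2, 9], [6, 3, 5, 0, 7, 4, 1, 9], [7, 2,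
    8, 1, 6, 9, 0, 4], [8, 1, 7, 2, 5, 9, 3, 4], [9, 1, 2, 7, 4, 8, 6, 5]]
  labellings := [[8, 9, 5, 4, 1, 7, 0, 6, 1, 2, 0, 3, 8, 2, 5, 3, 9, 7, 4, 6]]

/-- The data of `K_1_12`. -/
def data_K_1_12 : MapData 12 where
  faces := [[10, 9, 2], [10, 2, 6], [9, 8, 1], [9, 1, 2], [8, 11, 7], [8, 7, 1], [7, 3, 11], [3, 4, 11],
    [3, 0, 4], [0, 5, 4], [0, 6, 5], [6, 10, 5], [11, 4, 9, 10], [4, 5, 8, 9], [5, 10, 11, 8], [6,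
    2, 3, 7], [2, 1, 0, 3], [1, 7, 6, 0]]
  wheels := [[0, 4, 5, 6, 1, 3, 7, 2], [1, 8, 9, 2, 0, 7, 3, 6], [2, 9, 10, 6, 3, 1, 7, 0], [3, 4, 11, 7,
    2, 0, 6, 1], [4, 0, 3, 11, 9, 5, 10, 8], [5, 0, 6, 10, 8, 4, 11, 9], [6, 5, 10, 2, 7, 0, 3,
    1], [7, 8, 11, 3, 6, 1, 2, 0], [8, 1, 7, 11, 5, 9, 10, 4], [9, 1, 2, 10, 4, 8, 11, 5], [10, 2,
    6, 5, 11, 9, 8, 4], [11, 3, 7, 8, 10, 4, 5, 9]]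
  labellings := [[11, 4, 10, 9, 3, 7, 2, 6, 3, 0, 2, 1, 11, 8, 10, 5, 4, 5, 9, 8, 7, 1, 6, 0]]

/-- The data of `K_2_12`. -/
def data_K_2_12 : MapData 12 where
  faces := [[11, 5, 6], [5, 0, 6], [5, 4, 0], [4, 3, 0], [4, 11, 3], [11, 6, 3], [7, 1, 8], [1, 9, 8],
    [1, 2, 9], [2, 10, 9], [2, 7, 10], [7, 8, 10], [6, 0, 1, 7], [0, 3, 2, 1], [3, 6, 7, 2], [8,
    9, 5, 4], [9, 10, 11, 5], [10, 8, 4, 11]]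
  wheels := [[0, 4, 5, 6, 1, 3, 7, 2], [1, 8, 9, 2, 0, 7, 3, 6], [2, 9, 10, 7, 3, 1, 6, 0], [3, 4, 11, 6,
    2, 0, 7, 1], [4, 0, 3, 11, 8, 5, 10, 9], [5, 0, 6, 11, 9, 4, 10, 8], [6, 5, 11, 3, 7, 0, 2,
    1], [7, 8, 10, 2, 6, 1, 3, 0], [8, 1, 7, 10, 4, 9, 11, 5], [9, 1, 2, 10, 5, 8, 11, 4], [10, 2,
    7, 8, 11, 9, 4, 5], [11, 3, 6, 5, 10, 4, 9, 8]]
  labellings := [[0, 6, 1, 7, 5, 4, 9, 8, 5, 11, 9, 10, 8, 10, 4, 11, 0, 3, 1, 2, 6, 3, 7, 2], [3, 6, 2, 7,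
    11, 4, 10, 8, 11, 5, 10, 9, 3, 0, 2, 1, 7, 1, 6, 0, 4, 5, 8, 9], [6, 0, 7, 1, 5, 11, 9, 10, 5,
    4, 9, 8, 8, 10, 4, 11, 6, 3, 7, 2, 2, 1, 3, 0]]

/-- The data of `K_1_14`. -/
def data_K_1_14 : MapData 14 where
  faces := [[5, 6, 0], [4, 0, 3], [13, 3, 12], [6, 12, 5], [5, 4, 0], [4, 13, 3], [13, 6, 12], [8, 7, 1],
    [9, 1, 2], [10, 2, 11], [7, 11, 8], [8, 9, 1], [9, 10, 2], [10, 7, 11], [6, 0, 1, 7], [0, 3,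
    2, 1], [3, 12, 11, 2], [12, 5, 8, 11], [8, 9, 4, 5], [9, 10, 13, 4], [10, 7, 6, 13]]
  wheels := [[0, 4, 5, 6, 1, 3, 7, 2], [1, 8, 9, 2, 0, 7, 3, 6], [2, 9, 10, 11, 3, 1, 12, 0], [3, 4, 13,
    12, 2, 0, 11, 1], [4, 0, 3, 13, 9, 5, 10, 8], [5, 0, 6, 12, 8, 4, 11, 9], [6, 5, 12, 13, 7, 0,
    10, 1], [7, 8, 11, 10, 6, 1, 13, 0], [8, 1, 7, 11, 5, 9, 12, 4], [9, 1, 2, 10, 4, 8, 13, 5],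
    [10, 2, 11, 7, 13, 9, 6, 4], [11, 7, 10, 2, 12, 8, 3, 5], [12, 6, 13, 3, 11, 5, 2, 8], [13, 3,
    12, 6, 10, 4, 7, 9]]
  labellings := [[6, 0, 7, 1, 5, 12, 8, 11, 5, 4, 8, 9, 6, 13, 7, 10, 0, 3, 1, 2, 12, 3, 11, 2, 4, 13, 9, 10]]

/-- The data of `K_1_12_snub`. -/
def data_K_1_12_snub : MapData 12 where
  faces := [[5, 8, 4], [5, 4, 0], [9, 6, 7], [9, 7, 11], [7, 0, 1], [0, 2, 1], [4, 11, 3], [11, 10, 3],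
    [2, 3, 8], [2, 8, 9], [10, 1, 6], [10, 6, 5], [6, 5, 0, 7], [8, 9, 11, 4], [0, 4, 3, 2], [11,
    7, 1, 10], [1, 2, 9, 6], [3, 10, 5, 8]]
  wheels := [[0, 1, 2, 4, 5, 7, 3, 6], [1, 0, 2, 6, 10, 7, 9, 11], [2, 8, 3, 0, 1, 9, 4, 6], [3, 11, 4, 2,
    8, 10, 0, 5], [4, 5, 0, 3, 11, 8, 2, 9], [5, 4, 0, 6, 10, 8, 7, 3], [6, 10, 1, 9, 7, 5, 2, 0],
    [7, 9, 6, 0, 1, 11, 5, 10], [8, 2, 3, 5, 4, 9, 10, 11], [9, 7, 6, 2, 8, 11, 1, 4], [10, 6, 1,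
    11, 3, 5, 7, 8], [11, 3, 4, 9, 7, 10, 8, 1]]
  labellings := [[5, 6, 7, 0, 5, 10, 3, 8, 6, 9, 2, 1, 7, 1, 10, 11, 0, 4, 3, 2, 8, 4, 11, 9], [7, 0, 5, 6, 7,
    1, 10, 11, 0, 4, 3, 2, 5, 10, 3, 8, 6, 9, 2, 1, 11, 9, 8, 4], [0, 5, 6, 7, 0, 4, 3, 2, 5, 10,
    3, 8, 6, 9, 2, 1, 7, 1, 10, 11, 4, 11, 9, 8], [6, 7, 0, 5, 6, 9, 2, 1, 7, 1, 10, 11, 0, 4, 3,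
    2, 5, 10, 3, 8, 9, 8, 4, 11]]

/-- Whether the complete table `t` of `k` blocks is that of the given map. -/
def MapData.hasTable {n : ℕ} [NeZero n] (D : MapData n) (S : Scheme) (k t : ℕ) : Bool :=
  D.labellings.any fun g => S.isLabelling D.faces k t g

theorem isSEM_33344_of_isWheelSystem {n : ℕ} [NeZero n] (hn : n ≤ 32)
    {faces W : List (List (Fin n))} (h : isWheelSystem wheel33344 faces W = true) :
    IsSEM (ofLists faces) type33344 := by
  obtain ⟨h1, h2, h3⟩ := hasWheel_of_isWheelSystem hn (by decide) (by decide) h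
  exact isSEM_33344_of_hasWheel h1 h2 h3

theorem isSEM_33434_of_isWheelSystem {n : ℕ} [NeZero n] (hn : n ≤ 32)
    {faces W : List (List (Fin n))} (h : isWheelSystem wheel33434 faces W = true) :
    IsSEM (ofLists faces) type33434 := by
  obtain ⟨h1, h2, h3⟩ := hasWheel_of_isWheelSystem hn (by decide) (by decide) h
  exact isSEM_33434_of_hasWheel h1 h2 h3

theorem isSEM_T_1_10 : IsSEM T_1_10 type33344 :=
  isSEM_33344_of_isWheelSystem (W := data_T_1_10.wheels) (by norm_num) (by decide +kernel)

theorem isSEM_T_1_12 : IsSEM T_1_12 type33344 :=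
  isSEM_33344_of_isWheelSystem (W := data_T_1_12.wheels) (by norm_num) (by decide +kernel)

theorem isSEM_T_2_12 : IsSEM T_2_12 type33344 :=
  isSEM_33344_of_isWheelSystem (W := data_T_2_12.wheels) (by norm_num) (by decide +kernel)

theorem isSEM_T_3_12 : IsSEM T_3_12 type33344 :=
  isSEM_33344_of_isWheelSystem (W := data_T_3_12.wheels) (by norm_num) (by decide +kernel)

theorem isSEM_T_1_14 : IsSEM T_1_14 type33344 :=
  isSEM_33344_of_isWheelSystem (W := data_T_1_14.wheels) (by norm_num) (by decide +kernel)

theorem isSEM_T_2_14 : IsSEM T_2_14 type33344 :=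
  isSEM_33344_of_isWheelSystem (W := data_T_2_14.wheels) (by norm_num) (by decide +kernel)

theorem isSEM_K_1_10 : IsSEM K_1_10 type33344 :=
  isSEM_33344_of_isWheelSystem (W := data_K_1_10.wheels) (by norm_num) (by decide +kernel)

theorem isSEM_K_1_12 : IsSEM K_1_12 type33344 :=
  isSEM_33344_of_isWheelSystem (W := data_K_1_12.wheels) (by norm_num) (by decide +kernel)

theorem isSEM_K_2_12 : IsSEM K_2_12 type33344 :=
  isSEM_33344_of_isWheelSystem (W := data_K_2_12.wheels) (by norm_num) (by decide +kernel)

theorem isSEM_K_1_14 : IsSEM K_1_14 type33344 :=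
  isSEM_33344_of_isWheelSystem (W := data_K_1_14.wheels) (by norm_num) (by decide +kernel)

theorem isSEM_K_1_12_snub : IsSEM K_1_12_snub type33434 :=
  isSEM_33434_of_isWheelSystem (W := data_K_1_12_snub.wheels) (by norm_num) (by decide +kernel)

/-- Whether the complete table `t` of `k` blocks is that of one of the ten maps of type
`(3³, 4²)`. -/
def isTable33344 (k t : ℕ) : Bool :=
  data_T_1_10.hasTable scheme33344 k t ||
  data_T_1_12.hasTable scheme33344 k t ||
  data_T_2_12.hasTable scheme33344 k t ||
  data_T_3_12.hasTable scheme33344 k t ||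
  data_T_1_14.hasTable scheme33344 k t ||
  data_T_2_14.hasTable scheme33344 k t ||
  data_K_1_10.hasTable scheme33344 k t ||
  data_K_1_12.hasTable scheme33344 k t ||
  data_K_2_12.hasTable scheme33344 k t ||
  data_K_1_14.hasTable scheme33344 k t

-- Each recursive call matches two of at most 28 corners, so the depth stays well below the fuel 40.
set_option maxRecDepth 100000 in
theorem search_33344 : scheme33344.search isTable33344 40 1 0 = true := by
  decide +kernel

set_option maxRecDepth 100000 in
theorem search_33434 :
    scheme33434.search (data_K_1_12_snub.hasTable scheme33434) 40 1 0 = true := by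
  decide +kernel

theorem Iso.card_eq {V : Type*} [Fintype V] {M : Finset (Finset (Sym2 V))} {n : ℕ}
     {K : Finset (Finset (Sym2 (Fin n)))} (h : Iso M K) : Fintype.card V = n := by
  obtain ⟨f, -⟩ := h
  simpa using Fintype.card_congr f

/-! ### The classification of the maps of both types. -/

section Classification

variable {V : Type*} [Fintype V] [DecidableEq V] {M : Finset (Finset (Sym2 V))}

theorem IsSEM.iso_33344 (hM : IsSEM M type33344) (hV : Fintype.card V ≤ 15) :
    Iso M T_1_10 ∨ Iso M T_1_12 ∨ Iso M T_2_12 ∨ Iso M T_3_12 ∨ Iso M T_1_14 ∨ Iso M T_2_14 ∨ Iso M K_1_10 ∨ Iso M K_1_12 ∨ Iso M K_2_12 ∨ Iso M K_1_14 := by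
  have hw v := hasWheel_33344 hM.toIsPolyhedralComplex (hM.faceSequence v)
  obtain ⟨k, t, ht, H⟩ := (Corner33344.realization hw (mem_iff_isTri_or_isQuad hM.isCycle
    (card_eq_of_hasWheel hM.isCycle (by decide) hw))).exists_of_search lawful_scheme33344
      hM.covers hM.connected hV search_33344
  have hiso : ∀ {n : ℕ} [NeZero n] {D : MapData n}, n ≤ 32 →
      D.hasTable scheme33344 k t = true → Iso M (ofLists D.faces) := fun hn h => by
    obtain ⟨g, -, hg⟩ := List.any_eq_true.1 h
    exact H _ _ g hn hg
  simp only [isTable33344, Bool.or_eq_true, or_assoc] at ht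
  exact ht.imp (hiso (by norm_num)) <| .imp (hiso (by norm_num)) <| .imp (hiso (by norm_num)) <|
    .imp (hiso (by norm_num)) <| .imp (hiso (by norm_num)) <| .imp (hiso (by norm_num)) <|
    .imp (hiso (by norm_num)) <| .imp (hiso (by norm_num)) <| .imp (hiso (by norm_num)) <|
    hiso (by norm_num)

theorem IsSEM.iso_33434 (hM : IsSEM M type33434) (hV : Fintype.card V ≤ 15) :
    Iso M K_1_12_snub := by
  have hw v := hasWheel_33434 hM.toIsPolyhedralComplex (hM.faceSequence v)
  obtain ⟨k, t, ht, H⟩ := (Corner33434.realization hw (mem_iff_isTri_or_isQuad hM.isCycle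
    (card_eq_of_hasWheel hM.isCycle (by decide) hw))).exists_of_search lawful_scheme33434
      hM.covers hM.connected hV search_33434
  obtain ⟨g, -, hg⟩ := List.any_eq_true.1 ht
  exact H _ _ g (by norm_num) hg

end Classification

end SemiEquivelar

theorem lemma1 :
    (∀ (V : Type*) [Fintype V] [DecidableEq V] (M : Finset (Finset (Sym2 V))),
      (OnTorus M ∨ OnKleinBottle M) → Fintype.card V ≤ 15 →
        (IsSEM M type33344 →
          (Iso M T_1_10 ∨ Iso M T_1_12 ∨ Iso M T_2_12 ∨ Iso M T_3_12 ∨ Iso M T_1_14 ∨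
           Iso M T_2_14 ∨ Iso M K_1_10 ∨ Iso M K_1_12 ∨ Iso M K_2_12 ∨ Iso M K_1_14) ∧
          Fintype.card V ≠ 8) ∧
        (IsSEM M type33434 →
          Iso M K_1_12_snub ∧
          Fintype.card V ≠ 8 ∧ Fintype.card V ≠ 10 ∧ Fintype.card V ≠ 14)) ∧
    (IsSEM T_1_10 type33344 ∧ IsSEM T_1_12 type33344 ∧ IsSEM T_2_12 type33344 ∧
     IsSEM T_3_12 type33344 ∧ IsSEM T_1_14 type33344 ∧ IsSEM T_2_14 type33344 ∧
     IsSEM K_1_10 type33344 ∧ IsSEM K_1_12 type33344 ∧ IsSEM K_2_12 type33344 ∧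
     IsSEM K_1_14 type33344) ∧
    IsSEM K_1_12_snub type33434 := by
  refine ⟨fun V _ _ M _ hV => ⟨fun hM => ?_, fun hM => ?_⟩, ⟨isSEM_T_1_10, isSEM_T_1_12,
    isSEM_T_2_12, isSEM_T_3_12, isSEM_T_1_14, isSEM_T_2_14, isSEM_K_1_10, isSEM_K_1_12,
    isSEM_K_2_12, isSEM_K_1_14⟩, isSEM_K_1_12_snub⟩
  · have h := hM.iso_33344 hV
    refine ⟨h, ?_⟩
    -- An isomorphism fixes the number of vertices, and the listed maps have 10, 12 or 14.
    rcases h with h | h | h | h | h | h | h | h | h | h <;> rw [h.card_eq] <;> norm_num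
  · have h := hM.iso_33434 hV
    rw [h.card_eq]
    exact ⟨h, by norm_num⟩
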